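/- Let $\Omega=\{-1,+1\}^{\mathbb Z^2}$, $(\tau_v\sigma)_i=\sigma_{i-v}$, $(\Theta\sigma)_i=-\sigma_i$, $\Lambda_n=[-n,n]^2\cap\mathbb Z^2$, $M_n(\sigma)=|\Lambda_n|^{-1}\sum_{i\in\Lambda_n}\sigma_i$ and $C_0=\{\sigma\in\Omega: M_n(\sigma)\to 0\}$. Let $(P_t)_{t\ge 0}$ be the transition kernels of the infinite-volume, zero-field, continuous-time heat-bath Glauber dynamics of the nearest-neighbour Ising model on $\mathbb Z^2$ at inverse temperature $\beta\in\mathbb R$ (in particular, for any $\beta>\beta_c$), given by the Harris graphical construction: the sites carry independent rate-one Poisson clocks, and when the clock at $i$ rings the spin at $i$ is resampled, independently of everything else, to be $+1$ with probability $e^{\beta h}/(e^{\beta h}+e^{-\beta h})$ and $-1$ otherwise, where $h$ is the sum of the four neighbouring spins just before the ring. Write $\delta_\eta P_t$ for the law at time $t$ of the dynamics started from $\eta$. Call $\eta\in\Omega$ periodic antisymmetric if there are a finite-index subgroup $L\subset\mathbb Z^2$ and $u\in\mathbb Z^2$ with $\tau_\ell\eta=\eta$ for all $\ell\in L$ and $\tau_u\eta=\Theta\eta$.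 **Lemma (fixed-time centering).** For every periodic antisymmetric $\eta$ and every $t\ge 0$, $$\delta_\eta P_t(C_0)=1,$$ that is, $M_n\to 0$ almost surely under $\nu_t:=\delta_\eta P_t$. Moreover, for every finite-index subgroup $L\subset\mathbb Z^2$ and every $u\in\mathbb Z^2$ with $\tau_\ell\eta=\eta$ $(\ell\in L)$ and $\tau_u\eta=\Theta\eta$: the measure $\nu_t$ is invariant and ergodic under the translations $(\tau_\ell)_{\ell\in L}$; the coset means $c_a=\int_\Omega\sigma_a\,d\nu_t(\sigma)$ depend only on the class of $a$ in $\mathbb Z^2/L$; they satisfy $c_a=-c_{a+u}$ for all $a\in\mathbb Z^2/L$; and $\sum_{a\in\mathbb Z^2/L}c_a=0$. -/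

import Mathlib

namespace Glauber

open MeasureTheory ProbabilityTheory Filter Topology

/-- Sites of the square lattice. -/
abbrev Site : Type := ℤ × ℤ

/-- Spin configurations; the group `ℤˣ` of units of `ℤ` is the two-point set of spins `1`, `-1`. -/
abbrev Config : Type := Site → ℤˣ

instance discreteMeasurableSpace_spins : DiscreteMeasurableSpace ℤˣ := by
  have : MeasurableSingletonClass ℤˣ := by
    refine ⟨fun x => ⟨{(x : ℤ)}, measurableSet_singleton _, ?_⟩⟩
    ext y
    simp [Units.ext_iff]
  infer_instance

/-- The action of the lattice on configurations by translation: `(v +ᵥ σ) i = σ (i - v)`. -/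
instance translation : AddAction Site Config where
  vadd v σ := fun i => σ (i - v)
  zero_vadd σ := by
    funext i
    change σ (i - 0) = σ i
    rw [sub_zero]
  add_vadd v w σ := by
    funext i
    change σ (i - (v + w)) = σ (i - v - w)
    rw [sub_sub]

/-- The global spin-flip. -/
def spinFlip (σ : Config) : Config := fun i => -σ i

/-- The real value `1` or `-1` of the spin at a site. -/
def spin (σ : Config) (i : Site) : ℝ := ((σ i : ℤ) : ℝ)

/-- The box of sites with both coordinates between `-n` and `n`. -/
noncomputable def box (n : ℕ) : Finset Site := Finset.Icc (-(n : ℤ), -(n : ℤ)) ((n : ℤ), (n : ℤ))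

/-- The block magnetization. -/
noncomputable def magnetization (n : ℕ) (σ : Config) : ℝ :=
  (∑ i ∈ box n, spin σ i) / ((box n).card : ℝ)

/-- The centered sector: configurations whose block magnetizations tend to zero. -/
def centeredSector : Set Config :=
  {σ | Tendsto (fun n : ℕ => magnetization n σ) atTop (𝓝 0)}

/-- `η` is periodic under `L`, and its translate by `u` is its global spin-flip. -/
def IsAntiperiodic (L : AddSubgroup Site) (u : Site) (η : Config) : Prop :=
  (∀ l ∈ L, l +ᵥ η = η) ∧ u +ᵥ η = spinFlip η

/-- Periodic antisymmetric configurations. -/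
def antisymmetricConfigs : Set Config :=
  {η | ∃ L : AddSubgroup Site, L.FiniteIndex ∧ ∃ u : Site, IsAntiperiodic L u η}

/-- The four nearest neighbours of a site. -/
def neighbours (i : Site) : Finset Site :=
  {i + (1, 0), i - (1, 0), i + (0, 1), i - (0, 1)}

/-- The probability of a plus spin at `i` under the zero-field Ising Gibbs measure at inverse
temperature `β`, conditionally on the spins of `σ` at the neighbours of `i`. -/
noncomputable def plusProb (β : ℝ) (σ : Config) (i : Site) : ℝ :=
  Real.exp (β * ∑ j ∈ neighbours i, spin σ j) /
    (Real.exp (β * ∑ j ∈ neighbours i, spin σ j) + Real.exp (-(β * ∑ j ∈ neighbours i, spin σ j)))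

/-- Heat-bath resampling of the spin at `i`, driven by a uniform mark `v`. -/
noncomputable def heatBath (β : ℝ) (σ : Config) (i : Site) (v : unitInterval) : ℤˣ :=
  if (v : ℝ) ≤ plusProb β σ i then 1 else -1

/-- The marked clock of one site: the successive waiting times between rings, and the marks
attached to the rings. -/
abbrev Clock : Type := ℕ → ℝ × unitInterval

/-- The marked Harris noise: a marked clock at each site. -/
abbrev Noise : Type := Site → Clock

/-- The law of the Harris noise: all waiting times are exponential of rate one, all marks are
uniform on the unit interval, and all of them are independent. -/
noncomputable def noiseLaw : Measure Noise :=
  Measure.infinitePi fun _ : Site => Measure.infinitePi fun _ : ℕ =>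
    (expMeasure 1).prod (volume : Measure unitInterval)

instance isProbabilityMeasure_noiseLaw : IsProbabilityMeasure noiseLaw := by
  have : IsProbabilityMeasure (expMeasure 1) := isProbabilityMeasure_expMeasure zero_lt_one
  unfold noiseLaw
  infer_instance

/-- The time of the `k`-th ring, counted from `k = 0`. -/
def ringTime (w : Clock) (k : ℕ) : ℝ := ∑ m ∈ Finset.range (k + 1), (w m).1

/-- The number of rings of a clock in a set of times. Almost surely it is finite for every bounded
set of times. -/
noncomputable def ringCount (w : Clock) (S : Set ℝ) : ℕ := {k : ℕ | ringTime w k ∈ S}.ncard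

/-- `spinAfter β η ω n i k` is the spin at `i` just after the first `k` rings of the clock at `i`,
traced back through at most `n` generations of updates. For `k = 0` it is the initial spin. The ring
number `k` (that is, `ringTime (ω i) k`) resamples the spin at `i` by heat bath, given the spins of
the neighbours `j` just before that ring; those are the spins at `j` after all the rings of `j` at
strictly earlier times, traced back through at most `n - 1` generations. When the allowed number of
generations is exhausted the initial spin is returned. -/
noncomputable def spinAfter (β : ℝ) (η : Config) (ω : Noise) : ℕ → Site → ℕ → ℤˣ
  | 0, i, _ => η i
  | _ + 1, i, 0 => η i
  | n + 1, i, k + 1 =>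
      heatBath β
        (fun j => spinAfter β η ω n j (ringCount (ω j) (Set.Iio (ringTime (ω i) k))))
        i (ω i k).2

/-- The configuration at time `t` of the graphical construction started from `η`. Almost surely every
spin at time `t` depends on finitely many generations of updates only (the expected number of
chains of `n` successive updates along neighbouring sites in a time interval of length `t` is at
most `4 ^ n * t ^ n / n !`), so that `spinAfter β η ω n` is eventually constant in `n`, and the spin
is its eventual value. On the remaining null event the value is `-1`. -/
noncomputable def state (β t : ℝ) (η : Config) (ω : Noise) : Config := by
  classical
  exact fun i =>
    if ∀ᶠ n : ℕ in atTop, spinAfter β η ω n i (ringCount (ω i) (Set.Iic t)) = 1 then 1 else -1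

lemma measurable_ringTime (k : ℕ) : Measurable fun w : Clock => ringTime w k := by
  unfold ringTime
  fun_prop

lemma measurable_spin (i : Site) : Measurable fun σ : Config => spin σ i := by
  have h : Measurable fun x : ℤˣ => ((x : ℤ) : ℝ) := Measurable.of_discrete
  exact h.comp (measurable_pi_apply i)

lemma measurable_heatBath (β : ℝ) (i : Site) :
    Measurable fun p : Config × unitInterval => heatBath β p.1 i p.2 := by
  have hs : ∀ j : Site, Measurable fun p : Config × unitInterval => spin p.1 j :=
    fun j => (measurable_spin j).comp measurable_fst
  unfold heatBath plusProb
  refine Measurable.ite (measurableSet_le (by fun_prop) ?_) measurable_const measurable_const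
  have hsum : Measurable fun p : Config × unitInterval => ∑ j ∈ neighbours i, spin p.1 j :=
    Finset.measurable_sum _ fun j _ => hs j
  fun_prop

lemma measurable_spinAfter (β : ℝ) (n : ℕ) :
    ∀ (i : Site) (k : ℕ), Measurable fun p : Config × Noise => spinAfter β p.1 p.2 n i k := by
  induction n with
  | zero =>
    intro i k
    simp only [spinAfter]
    fun_prop
  | succ n ih =>
    intro i k
    cases k with
    | zero =>
      simp only [spinAfter]
      fun_prop
    | succ k =>
      simp only [spinAfter]
      have hT : ∀ (j : Site) (m : ℕ), Measurable fun p : Config × Noise => ringTime (p.2 j) m :=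
        fun j m => (measurable_ringTime m).comp (by fun_prop)
      have hN : ∀ j : Site, Measurable fun p : Config × Noise =>
          ringCount (p.2 j) (Set.Iio (ringTime (p.2 i) k)) := by
        intro j
        refine measurable_ncard.comp (measurable_set_iff.2 fun m => ?_)
        exact measurableSet_setOfPred.1 (measurableSet_lt (hT j m) (hT i k))
      have hc : Measurable fun p : Config × Noise => fun j : Site =>
          spinAfter β p.1 p.2 n j (ringCount (p.2 j) (Set.Iio (ringTime (p.2 i) k))) := by
        refine measurable_pi_lambda _ fun j => ?_
        have hj : Measurable fun q : (Config × Noise) × ℕ => spinAfter β q.1.1 q.1.2 n j q.2 :=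
          measurable_from_prod_countable_left fun m => ih j m
        exact hj.comp (measurable_id.prodMk (hN j))
      exact (measurable_heatBath β i).comp (hc.prodMk (by fun_prop))

lemma measurable_state (β t : ℝ) :
    Measurable fun p : Config × Noise => state β t p.1 p.2 := by
  classical
  refine measurable_pi_lambda _ fun i => ?_
  have hN : Measurable fun p : Config × Noise => ringCount (p.2 i) (Set.Iic t) := by
    refine measurable_ncard.comp (measurable_set_iff.2 fun m => ?_)
    refine measurableSet_setOfPred.1 (measurableSet_le (f := fun p : Config × Noise =>
      ringTime (p.2 i) m) ((measurable_ringTime m).comp (by fun_prop)) measurable_const)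
  have hs : ∀ n : ℕ, Measurable fun p : Config × Noise =>
      spinAfter β p.1 p.2 n i (ringCount (p.2 i) (Set.Iic t)) := by
    intro n
    have hj : Measurable fun q : (Config × Noise) × ℕ => spinAfter β q.1.1 q.1.2 n i q.2 :=
      measurable_from_prod_countable_left fun m => measurable_spinAfter β n i m
    exact hj.comp (measurable_id.prodMk hN)
  unfold state
  refine Measurable.ite ?_ measurable_const measurable_const
  simp only [eventually_atTop, Set.ofPred_exists, Set.ofPred_forall]
  exact MeasurableSet.iUnion fun a => MeasurableSet.iInter fun n => MeasurableSet.iInter fun _ =>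
    hs n (measurableSet_singleton 1)

/-- The transition kernel at time `t` of the infinite-volume heat-bath Glauber dynamics: from `η`,
the law of the configuration at time `t` of the graphical construction started from `η`. -/
noncomputable def glauberKernel (β t : ℝ) : Kernel Config Config where
  toFun η := noiseLaw.map (state β t η)
  measurable' := by
    refine Measure.measurable_of_measurable_coe _ fun s hs => ?_
    have h : ∀ η : Config, Measurable (state β t η) :=
      fun η => (measurable_state β t).comp measurable_prodMk_left
    simp only [fun η => Measure.map_apply (μ := noiseLaw) (h η) hs]
    exact measurable_measure_prodMk_left (measurable_state β t hs)

instance isMarkovKernel_glauberKernel (β t : ℝ) : IsMarkovKernel (glauberKernel β t) := by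
  refine ⟨fun η => ?_⟩
  have h : Measurable (state β t η) := (measurable_state β t).comp measurable_prodMk_left
  exact Measure.isProbabilityMeasure_map h.aemeasurable

/-- The law `δ_η P_t` at time `t` of the dynamics started from `η`. -/
noncomputable def lawAt (β t : ℝ) (η : Config) : Measure Config :=
  (Measure.dirac η).bind (glauberKernel β t)

end Glauber

/-!
The spins at time `t` are a factor of the independent noise, with fast decay of correlations, and
their means cancel by symmetry; so the block magnetizations obey a law of large numbers with
limit zero.

*Locality.* Cut the times up to `t + 1` into windows so short that a clock rings during a given
window with probability at most `1 / 8`. The sites ring independently, so a self-avoiding path of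
`r + 1` sites that all ring in one window has probability at most `8⁻¹ ^ (r + 1)`, and at most
`4 ^ r` such paths end at a given site. Off an event `bad` of exponentially small probability, no
such path occurs near `i` in any of the `M` windows. Tracing the spin at `i` back through the
successive updates, a window can then be crossed over a distance of at most `r` only, which is the
invariant `Admissible`. Hence the spin depends on the noise within distance `M * r` only
(`state_congr_of_notMem_bad`), and the graphical construction converges
(`eventually_spinAfter_eq_state`).

*Symmetry.* Translating the initial condition and the noise translates the state (`state_vadd`).
Flipping the initial condition and reflecting the marks `x ↦ 1 - x` flips the state almost surely
(`ae_state_spinFlip`); here the convergence of the construction is essential. So the mean spins are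
invariant under the periods and change sign under the antiperiod `u`, and their average over boxes
tends to zero (`tendsto_average_of_antiperiodic`).

*Ergodicity.* An event of the noise that is invariant under infinitely many translations is
approximated by cylinder events, which are independent of their far translates
(`noiseLaw_eq_zero_or_one_of_invariant`). This passes to the law at time `t`, by equivariance.

*Law of large numbers.* By locality, spins at distance `N` agree with independent ones off an event
whose probability is of order `N ^ (-4)` at most, so their covariances are summable over the lattice
(`exists_abs_covariance_spinAt_le`). The variance of the magnetization of a box is therefore at most
inversely proportional to the size of the box. In two dimensions these variances are summable along
all boxes, so the magnetizations converge to their means almost surely, without any maximal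
inequality or pointwise ergodic theorem.
-/

namespace Glauber

open MeasureTheory ProbabilityTheory Filter Topology

/-! ### Ring times of one clock -/

instance isProbabilityMeasure_expMeasure_one : IsProbabilityMeasure (expMeasure 1) :=
  isProbabilityMeasure_expMeasure zero_lt_one

/-- The law of one marked clock, a factor of `noiseLaw`. -/
noncomputable def clockLaw : Measure Clock :=
  Measure.infinitePi fun _ : ℕ => (expMeasure 1).prod (volume : Measure unitInterval)

instance isProbabilityMeasure_clockLaw : IsProbabilityMeasure clockLaw := by
  unfold clockLaw
  infer_instance

lemma noiseLaw_eq : noiseLaw = Measure.infinitePi fun _ : Site => clockLaw := rfl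

lemma iIndepFun_waiting : iIndepFun (fun (m : ℕ) (w : Clock) => (w m).1) clockLaw :=
  iIndepFun_infinitePi (X := fun _ => Prod.fst) fun _ => measurable_fst

lemma map_waiting (m : ℕ) : clockLaw.map (fun w : Clock => (w m).1) = expMeasure 1 := by
  have h : (fun w : Clock => (w m).1) = Prod.fst ∘ Function.eval m := rfl
  rw [h, ← Measure.map_map measurable_fst (measurable_pi_apply m), clockLaw,
    Measure.infinitePi_map_eval]
  simp

lemma map_mark (m : ℕ) : clockLaw.map (fun w : Clock => (w m).2) = volume := by
  have h : (fun w : Clock => (w m).2) = Prod.snd ∘ Function.eval m := rfl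
  rw [h, ← Measure.map_map measurable_snd (measurable_pi_apply m), clockLaw,
    Measure.infinitePi_map_eval]
  simp

lemma expMeasure_one_le_volume : expMeasure 1 ≤ volume := by
  have h : expMeasure 1 = volume.withDensity (exponentialPDF 1) := rfl
  rw [h]
  refine (withDensity_mono (ae_of_all _ fun x => ?_)).trans (withDensity_one (μ := volume)).le
  rw [exponentialPDF_eq, Pi.one_apply, ← ENNReal.ofReal_one]
  refine ENNReal.ofReal_le_ofReal ?_
  split_ifs with hx
  · simpa using hx
  · exact zero_le_one

lemma expMeasure_one_Iic_zero : expMeasure 1 (Set.Iic 0) = 0 := by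
  have h : expMeasure 1 = volume.withDensity (exponentialPDF 1) := rfl
  rw [h, withDensity_apply _ measurableSet_Iic, ← restrict_Iio_eq_restrict_Iic]
  exact lintegral_exponentialPDF_of_nonpos le_rfl

lemma ae_waiting_pos : ∀ᵐ w ∂clockLaw, ∀ m, 0 < (w m).1 := by
  refine ae_all_iff.2 fun m => ?_
  have hm : Measurable fun w : Clock => (w m).1 := by fun_prop
  have h : ∀ᵐ x ∂(clockLaw.map fun w : Clock => (w m).1), 0 < x := by
    rw [map_waiting, ae_iff]
    convert! expMeasure_one_Iic_zero using 2
    ext x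
    simp
  exact ae_of_ae_map hm.aemeasurable h

lemma ringTime_succ (w : Clock) (k : ℕ) : ringTime w (k + 1) = ringTime w k + (w (k + 1)).1 :=
  Finset.sum_range_succ _ _

/-- The last waiting time before a ring has a density bounded by one and is independent of the
earlier ones, so the ring time has a density bounded by one as well. -/
lemma clockLaw_ringTime_mem_le (k : ℕ) {s : Set ℝ} (hs : MeasurableSet s) :
    clockLaw {w | ringTime w k ∈ s} ≤ volume s := by
  have hind : IndepFun (∑ m ∈ Finset.range k, fun w : Clock => (w m).1)
      (fun w : Clock => (w k).1) clockLaw :=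
    iIndepFun_waiting.indepFun_finsetSum_of_notMem (fun m => by fun_prop) (by simp)
  have hm : Measurable (∑ m ∈ Finset.range k, fun w : Clock => (w m).1) := by fun_prop
  have hsum : (fun w : Clock => ringTime w k)
      = (∑ m ∈ Finset.range k, fun w : Clock => (w m).1) + fun w : Clock => (w k).1 := by
    funext w
    simp [ringTime, Finset.sum_range_succ]
  have hmap := hind.map_add_eq_map_conv_map hm (by fun_prop)
  rw [← hsum, map_waiting] at hmap
  have hprob : IsProbabilityMeasure
      (clockLaw.map (∑ m ∈ Finset.range k, fun w : Clock => (w m).1)) :=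
    Measure.isProbabilityMeasure_map hm.aemeasurable
  calc clockLaw {w | ringTime w k ∈ s}
      = (clockLaw.map fun w => ringTime w k) s :=
        (Measure.map_apply (measurable_ringTime k) hs).symm
    _ = ∫⁻ x, expMeasure 1 ((fun y => x + y) ⁻¹' s)
          ∂(clockLaw.map (∑ m ∈ Finset.range k, fun w : Clock => (w m).1)) := by
        rw [hmap, Measure.conv, Measure.map_apply (by fun_prop) hs,
          Measure.prod_apply (measurable_add hs)]
        rfl
    _ ≤ ∫⁻ _, volume s ∂(clockLaw.map (∑ m ∈ Finset.range k, fun w : Clock => (w m).1)) := by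
        refine lintegral_mono fun x => (expMeasure_one_le_volume _).trans ?_
        rw [measure_preimage_add]
    _ = volume s := by simp

/-- A Chernoff bound: the Laplace transform of the `k`-th ring time is a `k`-th power. -/
lemma tendsto_clockLaw_ringTime_le (s : ℝ) :
    Tendsto (fun k => clockLaw {w | ringTime w k ≤ s}) atTop (𝓝 0) := by
  set c := mgf id (expMeasure 1) (-1) with hc
  have hmgf : ∀ m : ℕ, mgf (fun w : Clock => (w m).1) clockLaw (-1) = c := by
    intro m
    have hm : Measurable fun w : Clock => (w m).1 := by fun_prop
    rw [hc, ← map_waiting m, mgf_id_map hm.aemeasurable]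
  have hpos : ∀ᵐ x ∂(expMeasure 1), 0 < x := by
    rw [ae_iff]
    convert! expMeasure_one_Iic_zero using 2
    ext x
    simp
  have hint : Integrable (fun x : ℝ => Real.exp (-1 * id x)) (expMeasure 1) := by
    refine Integrable.of_bound (by fun_prop) 1 (hpos.mono fun x hx => ?_)
    rw [Real.norm_eq_abs, abs_of_pos (Real.exp_pos _)]
    simpa using hx.le
  have hc0 : 0 ≤ c := mgf_nonneg
  have hc1 : c < 1 := by
    have h0 : 0 < ∫ x, (1 - Real.exp (-1 * id x)) ∂(expMeasure 1) := by
      rw [integral_pos_iff_support_of_nonneg_ae]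
      · have : (expMeasure 1) (Function.support fun x : ℝ => 1 - Real.exp (-1 * id x)) = 1 := by
          rw [← prob_compl_eq_zero_iff]
          · refine measure_mono_null ?_ expMeasure_one_Iic_zero
            intro x hx
            simp only [Function.support, Set.mem_compl_iff, Set.mem_ofPred_eq, not_not] at hx
            have : Real.exp (-1 * id x) = 1 := by linarith
            rw [Real.exp_eq_one_iff] at this
            simp at this
            simp [this]
          · exact measurableSet_support (by fun_prop)
        rw [this]
        exact zero_lt_one
      · refine hpos.mono fun x hx => ?_
        have : Real.exp (-1 * id x) ≤ 1 := by simpa using hx.le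
        simpa using this
      · exact (integrable_const 1).sub hint
    rw [integral_sub (integrable_const 1) hint] at h0
    simp only [integral_const, probReal_univ, smul_eq_mul, mul_one] at h0
    have : c = ∫ x, Real.exp (-1 * id x) ∂(expMeasure 1) := rfl
    linarith
  have hbound : ∀ k,
      clockLaw {w | ringTime w k ≤ s} ≤ ENNReal.ofReal (Real.exp s * c ^ (k + 1)) := by
    intro k
    have hsum : (fun w : Clock => ringTime w k)
        = ∑ m ∈ Finset.range (k + 1), fun w : Clock => (w m).1 := by
      funext w
      simp [ringTime]
    have h1 : mgf (fun w : Clock => ringTime w k) clockLaw (-1) = c ^ (k + 1) := by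
      rw [hsum, iIndepFun_waiting.mgf_sum fun m => by fun_prop]
      simp [hmgf]
    have h2 : Integrable (fun w : Clock => Real.exp (-1 * ringTime w k)) clockLaw := by
      refine Integrable.of_bound
        (((measurable_ringTime k).const_mul (-1)).exp.aestronglyMeasurable) 1
        (ae_waiting_pos.mono fun w hw => ?_)
      rw [Real.norm_eq_abs, abs_of_pos (Real.exp_pos _)]
      have : 0 ≤ ringTime w k := Finset.sum_nonneg fun m _ => (hw m).le
      simpa using this
    have h3 := measure_le_le_exp_mul_mgf (μ := clockLaw) (X := fun w : Clock => ringTime w k) s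
      (t := -1) (by norm_num) h2
    rw [h1] at h3
    rw [← ofReal_measureReal]
    refine ENNReal.ofReal_le_ofReal (h3.trans_eq ?_)
    simp
  have hlim : Tendsto (fun k : ℕ => ENNReal.ofReal (Real.exp s * c ^ (k + 1))) atTop (𝓝 0) := by
    have h := ((tendsto_pow_atTop_nhds_zero_of_lt_one hc0 hc1).comp
      (tendsto_add_atTop_nat 1)).const_mul (Real.exp s)
    rw [mul_zero] at h
    have := (ENNReal.continuous_ofReal.tendsto 0).comp h
    rwa [ENNReal.ofReal_zero] at this
  exact tendsto_of_tendsto_of_tendsto_of_le_of_le tendsto_const_nhds hlim (fun _ => zero_le) hbound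

/-- A clock is regular if its waiting times are positive and it rings finitely often in bounded
time. -/
def IsRegular (w : Clock) : Prop :=
  (∀ m, 0 < (w m).1) ∧ ∀ s : ℝ, ∃ k, s < ringTime w k

lemma ae_isRegular : ∀ᵐ w ∂clockLaw, IsRegular w := by
  have h : ∀ n : ℕ, ∀ᵐ w ∂clockLaw, ∃ k, (n : ℝ) < ringTime w k := by
    intro n
    rw [ae_iff]
    refine le_antisymm (ge_of_tendsto' (tendsto_clockLaw_ringTime_le n) fun k => ?_) zero_le
    refine measure_mono fun w hw => ?_
    simp only [not_exists, not_lt, Set.mem_ofPred_eq] at hw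
    exact hw k
  filter_upwards [ae_waiting_pos, ae_all_iff.2 h] with w h1 h2
  refine ⟨h1, fun s => ?_⟩
  obtain ⟨n, hn⟩ := exists_nat_gt s
  obtain ⟨k, hk⟩ := h2 n
  exact ⟨k, hn.trans hk⟩

lemma IsRegular.strictMono {w : Clock} (hw : IsRegular w) : StrictMono (ringTime w) :=
  strictMono_nat_of_lt_succ fun k => by
    rw [ringTime_succ]
    linarith [hw.1 (k + 1)]

lemma IsRegular.ringTime_pos {w : Clock} (hw : IsRegular w) (k : ℕ) : 0 < ringTime w k :=
  Finset.sum_pos (fun m _ => hw.1 m) (by simp)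

/-- The rings of a regular clock before a time are the first ones, as many as there are. -/
lemma IsRegular.lt_ringCount_iff {w : Clock} (hw : IsRegular w) {S : Set ℝ} {s : ℝ}
    (hS : S ⊆ Set.Iic s) (hlow : IsLowerSet S) (k : ℕ) :
    k < ringCount w S ↔ ringTime w k ∈ S := by
  obtain ⟨K, hK⟩ := hw.2 s
  have hex : ∃ n, ringTime w n ∉ S := ⟨K, fun h => (hS h).not_gt hK⟩
  classical
  have hset : {k : ℕ | ringTime w k ∈ S} = Set.Iio (Nat.find hex) := by
    ext n
    simp only [Set.mem_ofPred_eq, Set.mem_Iio, Nat.lt_find_iff, not_not]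
    exact ⟨fun h m hm => hlow (hw.strictMono.monotone hm) h, fun h => h n le_rfl⟩
  have hcard : ringCount w S = Nat.find hex := by
    rw [ringCount, hset, Set.ncard_eq_toFinset_card']
    simp
  rw [hcard, ← Set.mem_Iio, ← hset]
  rfl

/-- The `m`-th of the windows of equal lengths that cut the times up to `t + 1` into `M` pieces. -/
def window (t : ℝ) (M m : ℕ) : Set ℝ :=
  Set.Ioc (m * ((t + 1) / M)) ((m + 1) * ((t + 1) / M))

/-- The clocks that ring during a window. -/
def ringing (t : ℝ) (M m : ℕ) : Set Clock := {w | ∃ k, ringTime w k ∈ window t M m}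

lemma measurableSet_ringing (t : ℝ) (M m : ℕ) : MeasurableSet (ringing t M m) := by
  have : ringing t M m = ⋃ k, (fun w => ringTime w k) ⁻¹' window t M m := by
    ext w
    simp [ringing]
  rw [this]
  exact MeasurableSet.iUnion fun k => measurable_ringTime k measurableSet_Ioc

/-- Short windows make it unlikely that a given clock rings during a given window, at a level below
the inverse of the number of neighbours of a site. -/
lemma exists_clockLaw_ringing_le {t : ℝ} (ht : 0 ≤ t) :
    ∃ M : ℕ, 0 < M ∧ ∀ m < M, clockLaw (ringing t M m) ≤ 8⁻¹ := by
  obtain ⟨K, hK⟩ := ((tendsto_clockLaw_ringTime_le (t + 1)).eventually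
    (gt_mem_nhds (show (0 : ENNReal) < 16⁻¹ by simp))).exists
  have hlim : Tendsto (fun M : ℕ => ENNReal.ofReal (K * ((t + 1) / M))) atTop (𝓝 0) := by
    have h := (tendsto_const_div_atTop_nhds_zero_nat (t + 1)).const_mul (K : ℝ)
    rw [mul_zero] at h
    have := (ENNReal.continuous_ofReal.tendsto 0).comp h
    rwa [ENNReal.ofReal_zero] at this
  obtain ⟨M, hM, hM0⟩ := ((hlim.eventually
    (gt_mem_nhds (show (0 : ENNReal) < 16⁻¹ by simp))).and (eventually_gt_atTop 0)).exists
  refine ⟨M, hM0, fun m hm => ?_⟩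
  have hMr : (0 : ℝ) < M := by exact_mod_cast hM0
  have hend : ((m : ℝ) + 1) * ((t + 1) / M) ≤ t + 1 := by
    have h1 : (m : ℝ) + 1 ≤ M := by exact_mod_cast hm
    calc ((m : ℝ) + 1) * ((t + 1) / M) ≤ M * ((t + 1) / M) := by gcongr
      _ = t + 1 := by field_simp
  have hsub : ringing t M m ≤ᵐ[clockLaw] ((⋃ k ∈ Finset.range K, {w | ringTime w k ∈ window t M m})
      ∪ {w | ringTime w K ≤ t + 1} : Set Clock) := by
    filter_upwards [ae_isRegular] with w hw hr
    obtain ⟨k, hk⟩ := hr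
    rcases lt_or_ge k K with h | h
    · left
      exact Set.mem_biUnion (Finset.mem_coe.2 (Finset.mem_range.2 h)) hk
    · right
      exact (hw.strictMono.monotone h).trans (hk.2.trans hend)
  calc clockLaw (ringing t M m) ≤ _ := measure_mono_ae hsub
    _ ≤ (∑ k ∈ Finset.range K, clockLaw {w | ringTime w k ∈ window t M m})
          + clockLaw {w | ringTime w K ≤ t + 1} :=
        (measure_union_le _ _).trans (by gcongr; exact measure_biUnion_finset_le _ _)
    _ ≤ (∑ k ∈ Finset.range K, ENNReal.ofReal ((t + 1) / M)) + 16⁻¹ := by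
        gcongr with k _
        refine (clockLaw_ringTime_mem_le k measurableSet_Ioc).trans_eq ?_
        rw [Real.volume_Ioc]
        congr 1
        ring
    _ ≤ 16⁻¹ + 16⁻¹ := by
        gcongr
        refine le_trans (le_of_eq ?_) hM.le
        rw [Finset.sum_const, Finset.card_range, nsmul_eq_mul, ENNReal.ofReal_mul (by positivity)]
        simp
    _ = 8⁻¹ := by
        rw [← two_mul, show (16 : ENNReal) = 2 * 8 by norm_num,
          ENNReal.mul_inv (by simp) (by simp), ← mul_assoc,
          ENNReal.mul_inv_cancel (by simp) (by simp), one_mul]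

/-! ### Paths of ringing sites -/

/-- The square of sites at sup-distance at most `R` from `i`. -/
noncomputable def nearby (i : Site) (R : ℕ) : Finset Site :=
  Finset.Icc (i - ((R : ℤ), (R : ℤ))) (i + ((R : ℤ), (R : ℤ)))

lemma mem_nearby {i j : Site} {R : ℕ} :
    j ∈ nearby i R ↔ i.1 - R ≤ j.1 ∧ i.2 - R ≤ j.2 ∧ j.1 ≤ i.1 + R ∧ j.2 ≤ i.2 + R := by
  simp only [nearby, Finset.mem_Icc, Prod.le_def, Prod.fst_sub, Prod.snd_sub, Prod.fst_add,
    Prod.snd_add]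
  tauto

lemma card_nearby (i : Site) (R : ℕ) : (nearby i R).card = (2 * R + 1) ^ 2 := by
  rw [nearby, Finset.Icc_prod_def, Finset.card_product, Int.card_Icc, Int.card_Icc, sq]
  simp only [Prod.fst_sub, Prod.snd_sub, Prod.fst_add, Prod.snd_add]
  congr 1 <;> omega

lemma mem_nearby_self (i : Site) (R : ℕ) : i ∈ nearby i R := by
  rw [mem_nearby]
  omega

lemma mem_nearby_trans {i j k : Site} {R S T : ℕ} (h : j ∈ nearby i R) (h' : k ∈ nearby j S)
    (hT : R + S ≤ T) : k ∈ nearby i T := by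
  rw [mem_nearby] at *
  omega

lemma mem_neighbours {i j : Site} :
    j ∈ neighbours i ↔ j = i + (1, 0) ∨ j = i - (1, 0) ∨ j = i + (0, 1) ∨ j = i - (0, 1) := by
  simp [neighbours]

lemma card_neighbours_le (i : Site) : (neighbours i).card ≤ 4 := Finset.card_le_four

lemma mem_nearby_of_mem_neighbours {i j : Site} (h : j ∈ neighbours i) : j ∈ nearby i 1 := by
  rw [mem_neighbours] at h
  rw [mem_nearby]
  rcases h with rfl | rfl | rfl | rfl <;> simp <;> omega

/-- The relation of a site to its predecessor along a path that is listed from its end: each site is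
a neighbour of the next one in the list. -/
def Step (x y : Site) : Prop := x ∈ neighbours y

/-- The lists of `r + 1` successively neighbouring sites that end at `j`. -/
noncomputable def pathsTo : ℕ → Site → Finset (List Site)
  | 0, j => {[j]}
  | r + 1, j => (pathsTo r j).biUnion fun l => (neighbours (l.headD j)).image (· :: l)

lemma card_pathsTo_le (r : ℕ) (j : Site) : (pathsTo r j).card ≤ 4 ^ r := by
  induction r with
  | zero => simp [pathsTo]
  | succ r ih =>
    rw [pathsTo, pow_succ]
    refine (Finset.card_biUnion_le_card_mul _ _ 4 fun l _ => ?_).trans (Nat.mul_le_mul_right 4 ih)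
    exact Finset.card_image_le.trans (card_neighbours_le _)

lemma mem_pathsTo {r : ℕ} {l : List Site} {j : Site} (hl : l.length = r + 1)
    (hc : l.IsChain Step) (hj : l.getLast? = some j) : l ∈ pathsTo r j := by
  induction r generalizing l with
  | zero =>
    obtain ⟨a, rfl⟩ := List.length_eq_one_iff.1 hl
    simp only [List.getLast?_singleton, Option.some.injEq] at hj
    simp [pathsTo, hj]
  | succ r ih =>
    match l, hl, hc, hj with
    | a :: b :: l, hl, hc, hj =>
      rw [List.isChain_cons_cons] at hc
      rw [List.getLast?_cons_cons] at hj
      rw [pathsTo, Finset.mem_biUnion]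
      refine ⟨b :: l, ih (by simpa using hl) hc.2 hj, Finset.mem_image.2 ⟨a, ?_, rfl⟩⟩
      simpa [Step] using hc.1

lemma length_of_mem_pathsTo {r : ℕ} {l : List Site} {j : Site} (h : l ∈ pathsTo r j) :
    l.length = r + 1 := by
  induction r generalizing l with
  | zero => simp_all [pathsTo]
  | succ r ih =>
    rw [pathsTo, Finset.mem_biUnion] at h
    obtain ⟨l', hl', h⟩ := h
    obtain ⟨a, -, rfl⟩ := Finset.mem_image.1 h
    rw [List.length_cons, ih hl']

/-- A path along which the spin at `j` may be traced back during the `m`-th window: a self-avoiding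
list of successively neighbouring sites whose clocks all ring during that window. It is listed
backwards, with `j` as its last entry. -/
structure IsRingingPath (ω : Noise) (t : ℝ) (M m : ℕ) (j : Site) (l : List Site) : Prop where
  chain : l.IsChain Step
  nodup : l.Nodup
  last : l.getLast? = some j
  rings : ∀ x ∈ l, ω x ∈ ringing t M m

/-- The event that a long ringing path, of `r + 1` sites, ends not too far from `i` in some window.
Off this event, the spin at `i` at time `t` depends on the noise near `i` only. -/
def bad (t : ℝ) (M r : ℕ) (i : Site) : Set Noise :=
  {ω | ∃ m < M, ∃ j ∈ nearby i (M * r), ∃ l : List Site, l.length = r + 1 ∧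
    IsRingingPath ω t M m j l}

/-- Sites ring independently, so a self-avoiding path rings with exponentially small
probability. -/
lemma noiseLaw_forall_ringing_le {t : ℝ} {M m : ℕ} (h : clockLaw (ringing t M m) ≤ 8⁻¹)
    {l : List Site} (hl : l.Nodup) :
    noiseLaw {ω | ∀ x ∈ l, ω x ∈ ringing t M m} ≤ 8⁻¹ ^ l.length := by
  have hset : {ω : Noise | ∀ x ∈ l, ω x ∈ ringing t M m}
      = Set.pi (l.toFinset : Set Site) fun _ => ringing t M m := by
    ext ω
    simp
  rw [hset, noiseLaw_eq, Measure.infinitePi_pi _ fun _ _ => measurableSet_ringing t M m,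
    Finset.prod_const, List.toFinset_card_of_nodup hl]
  gcongr

lemma noiseLaw_bad_le {t : ℝ} {M : ℕ} (h : ∀ m < M, clockLaw (ringing t M m) ≤ 8⁻¹) (r : ℕ)
    (i : Site) : noiseLaw (bad t M r i) ≤ M * ((2 * (M * r) + 1) ^ 2 * 2⁻¹ ^ r) := by
  have hsub : bad t M r i ⊆ ⋃ m ∈ Finset.range M, ⋃ j ∈ nearby i (M * r),
      ⋃ l ∈ (pathsTo r j).filter List.Nodup, {ω | ∀ x ∈ l, ω x ∈ ringing t M m} := by
    rintro ω ⟨m, hm, j, hj, l, hl, hp⟩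
    simp only [Set.mem_iUnion]
    exact ⟨m, Finset.mem_range.2 hm, j, hj, l,
      Finset.mem_filter.2 ⟨mem_pathsTo hl hp.chain hp.last, hp.nodup⟩, hp.rings⟩
  have hfour : (4 : ENNReal) ^ r * 8⁻¹ ^ (r + 1) ≤ 2⁻¹ ^ r := by
    have h8 : (8⁻¹ : ENNReal) = 4⁻¹ * 2⁻¹ := by
      rw [← ENNReal.mul_inv (by simp) (by simp)]
      norm_num
    calc (4 : ENNReal) ^ r * 8⁻¹ ^ (r + 1) ≤ 4 ^ r * 8⁻¹ ^ r := by
          gcongr 4 ^ r * ?_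
          exact pow_le_pow_of_le_one zero_le (by simp) (Nat.le_succ r)
      _ = 2⁻¹ ^ r := by
          rw [h8, mul_pow, ← mul_assoc, ← mul_pow, ENNReal.mul_inv_cancel (by simp) (by simp),
            one_pow, one_mul]
  calc noiseLaw (bad t M r i)
      ≤ ∑ m ∈ Finset.range M, ∑ j ∈ nearby i (M * r),
          ∑ l ∈ (pathsTo r j).filter List.Nodup,
            noiseLaw {ω | ∀ x ∈ l, ω x ∈ ringing t M m} := by
        refine (measure_mono hsub).trans ((measure_biUnion_finset_le _ _).trans ?_)
        gcongr
        refine (measure_biUnion_finset_le _ _).trans ?_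
        gcongr
        exact measure_biUnion_finset_le _ _
    _ ≤ ∑ m ∈ Finset.range M, ∑ j ∈ nearby i (M * r),
          ∑ l ∈ (pathsTo r j).filter List.Nodup, (8⁻¹ : ENNReal) ^ (r + 1) := by
        gcongr with m hm j hj l hl
        obtain ⟨hl1, hl2⟩ := Finset.mem_filter.1 hl
        have := noiseLaw_forall_ringing_le (h m (Finset.mem_range.1 hm)) hl2
        rwa [length_of_mem_pathsTo hl1] at this
    _ ≤ ∑ m ∈ Finset.range M, ∑ j ∈ nearby i (M * r), (2⁻¹ : ENNReal) ^ r := by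
        gcongr with m hm j hj
        rw [Finset.sum_const, nsmul_eq_mul]
        refine le_trans ?_ hfour
        gcongr
        exact_mod_cast (Finset.card_filter_le _ _).trans (card_pathsTo_le r j)
    _ = M * ((2 * (M * r) + 1) ^ 2 * 2⁻¹ ^ r) := by
        simp [card_nearby]

/-- The probability of long ringing paths decays faster than the fourth power. -/
lemma exists_noiseLaw_bad_le {t : ℝ} {M : ℕ} (h : ∀ m < M, clockLaw (ringing t M m) ≤ 8⁻¹) :
    ∃ C : ℝ, 0 ≤ C ∧ ∀ (r : ℕ) (i : Site),
      noiseLaw.real (bad t M r i) ≤ C / ((r : ℝ) + 1) ^ 4 := by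
  have hlim : Tendsto (fun r : ℕ => ((r + 1 : ℕ) : ℝ) ^ 6 * (1 / 2 : ℝ) ^ (r + 1)) atTop (𝓝 0) :=
    (tendsto_pow_const_mul_const_pow_of_lt_one 6 (by norm_num) (by norm_num)).comp
      (tendsto_add_atTop_nat 1)
  obtain ⟨B, hB⟩ := hlim.bddAbove_range
  have hB0 : ∀ r : ℕ, ((r : ℝ) + 1) ^ 6 * (1 / 2) ^ (r + 1) ≤ B := fun r => by
    have := hB ⟨r, rfl⟩
    simpa using this
  have hBpos : 0 ≤ B := le_trans (by positivity) (hB0 0)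
  refine ⟨M * (2 * M + 1) ^ 2 * 2 * B, by positivity, fun r i => ?_⟩
  have h1 : noiseLaw.real (bad t M r i) ≤ M * ((2 * (M * r) + 1) ^ 2 * (1 / 2) ^ r) := by
    refine ENNReal.toReal_le_of_le_ofReal (by positivity) ((noiseLaw_bad_le h r i).trans_eq ?_)
    have e2 : (2⁻¹ : ENNReal) = ENNReal.ofReal (1 / 2) := by
      rw [one_div, ENNReal.ofReal_inv_of_pos (by norm_num)]
      simp
    have e3 : (2 * ((M : ENNReal) * r) + 1) = ENNReal.ofReal (2 * (M * r) + 1) := by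
      rw [show (2 * ((M : ℝ) * r) + 1) = ((2 * (M * r) + 1 : ℕ) : ℝ) by push_cast; ring,
        ENNReal.ofReal_natCast]
      push_cast
      ring
    rw [e2, e3, ← ENNReal.ofReal_natCast M, ← ENNReal.ofReal_pow (by positivity),
      ← ENNReal.ofReal_pow (by positivity), ← ENNReal.ofReal_mul (by positivity),
      ← ENNReal.ofReal_mul (by positivity)]
  rw [le_div_iff₀ (by positivity)]
  have h2 : (2 * ((M : ℝ) * r) + 1) ≤ (2 * M + 1) * (r + 1) := by
    have : (0 : ℝ) ≤ M := by positivity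
    have : (0 : ℝ) ≤ r := by positivity
    nlinarith
  calc noiseLaw.real (bad t M r i) * ((r : ℝ) + 1) ^ 4
      ≤ M * (((2 * M + 1) * (r + 1)) ^ 2 * (1 / 2) ^ r) * ((r : ℝ) + 1) ^ 4 := by
        refine mul_le_mul_of_nonneg_right (h1.trans ?_) (by positivity)
        gcongr
    _ = M * (2 * M + 1) ^ 2 * 2 * (((r : ℝ) + 1) ^ 6 * (1 / 2) ^ (r + 1)) := by ring
    _ ≤ M * (2 * M + 1) ^ 2 * 2 * B := by
        gcongr
        exact hB0 r

/-! ### Locality of the graphical construction -/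

lemma mem_nearby_of_isChain {l : List Site} {x j : Site} (hc : (x :: l).IsChain Step)
    (hj : (x :: l).getLast? = some j) : x ∈ nearby j l.length := by
  induction l generalizing x with
  | nil =>
    simp only [List.getLast?_singleton, Option.some.injEq] at hj
    exact hj ▸ mem_nearby_self _ _
  | cons y l ih =>
    rw [List.isChain_cons_cons] at hc
    rw [List.getLast?_cons_cons] at hj
    exact mem_nearby_trans (ih hc.2 hj) (mem_nearby_of_mem_neighbours hc.1) le_rfl

lemma exists_mem_window {t : ℝ} (ht : 0 ≤ t) {M : ℕ} (hM : 0 < M) {s : ℝ} (h0 : 0 < s)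
    (h1 : s ≤ t + 1) : ∃ m < M, s ∈ window t M m := by
  have hMr : (0 : ℝ) < M := by exact_mod_cast hM
  have hδ : 0 < (t + 1) / M := by positivity
  have hc : 0 < ⌈s / ((t + 1) / M)⌉₊ := Nat.ceil_pos.2 (by positivity)
  obtain ⟨m, hm⟩ := Nat.exists_eq_succ_of_ne_zero hc.ne'
  refine ⟨m, ?_, ?_, ?_⟩
  · have : ⌈s / ((t + 1) / M)⌉₊ ≤ M := by
      rw [Nat.ceil_le, div_le_iff₀ hδ]
      calc s ≤ t + 1 := h1
        _ = M * ((t + 1) / M) := by field_simp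
    omega
  · rw [← lt_div_iff₀ hδ]
    exact Nat.lt_ceil.1 (by omega)
  · rw [← div_le_iff₀ hδ]
    have := Nat.le_ceil (s / ((t + 1) / M))
    rw [hm] at this
    exact_mod_cast this

lemma window_le {t : ℝ} (ht : 0 ≤ t) {M m : ℕ} (hm : m < M) {s : ℝ} (hs : s ∈ window t M m) :
    s ≤ t + 1 := by
  have hMr : (0 : ℝ) < M := by exact_mod_cast (Nat.zero_le m).trans_lt hm
  have h1 : (m : ℝ) + 1 ≤ M := by exact_mod_cast hm
  calc s ≤ ((m : ℝ) + 1) * ((t + 1) / M) := hs.2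
    _ ≤ M * ((t + 1) / M) := by gcongr
    _ = t + 1 := by field_simp

lemma window_index_le {t : ℝ} (ht : 0 ≤ t) {M m m' : ℕ} (hM : 0 < M) {s s' : ℝ}
    (hs : s ∈ window t M m) (hs' : s' ∈ window t M m') (h : s' < s) : m' ≤ m := by
  have hMr : (0 : ℝ) < M := by exact_mod_cast hM
  have hδ : 0 < (t + 1) / M := by positivity
  have h1 : (m' : ℝ) * ((t + 1) / M) < (m + 1) * ((t + 1) / M) := hs'.1.trans (h.trans_le hs.2)
  have h2 : (m' : ℝ) < m + 1 := lt_of_mul_lt_mul_right h1 hδ.le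
  exact Nat.lt_succ_iff.1 (by exact_mod_cast h2)

lemma heatBath_congr (β : ℝ) {σ σ' : Config} {i : Site} (v : unitInterval)
    (h : ∀ j ∈ neighbours i, σ j = σ' j) : heatBath β σ i v = heatBath β σ' i v := by
  have hs : ∑ j ∈ neighbours i, spin σ j = ∑ j ∈ neighbours i, spin σ' j :=
    Finset.sum_congr rfl fun j hj => by rw [spin, spin, h j hj]
  have hp : plusProb β σ i = plusProb β σ' i := by rw [plusProb, plusProb, hs]
  rw [heatBath, heatBath, hp]

lemma IsRegular.ringCount_Iio_mono {w : Clock} (hw : IsRegular w) {s s' : ℝ} (h : s ≤ s') :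
    ringCount w (Set.Iio s) ≤ ringCount w (Set.Iio s') := by
  refine le_of_forall_lt fun k hk => ?_
  rw [hw.lt_ringCount_iff Set.Iio_subset_Iic_self (isLowerSet_Iio _)] at hk ⊢
  exact hk.trans_le h

/-- The pairs of a site `j` and a number `k` of rings whose update may be traced back to from the
spin at `i`. A ring of the `m`-th window is to be joined by a short ringing path to a site at which
this window was entered, and that site has to be the closer to `i` the later the window. Both
demands persist from one generation of updates to the preceding one. -/
def Admissible (t : ℝ) (M r : ℕ) (i : Site) (ω : Noise) (j : Site) (k : ℕ) : Prop :=
  ∀ k', k = k' + 1 → ∃ m < M, ringTime (ω j) k' ∈ window t M m ∧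
    ∃ j₀ ∈ nearby i ((M - 1 - m) * r), ∃ l : List Site, (j :: l).length ≤ r ∧
      IsRingingPath ω t M m j₀ (j :: l)

section Deterministic

variable {t : ℝ} {M r : ℕ} {i : Site} {ω : Noise}

lemma nearby_stage_subset {m : ℕ} (hm : m < M) :
    nearby i ((M - 1 - m) * r) ⊆ nearby i (M * r) := fun j hj =>
  mem_nearby_trans hj (mem_nearby_self j 0) (by
    have : M - 1 - m ≤ M := by omega
    simpa using Nat.mul_le_mul_right r this)

lemma IsRingingPath.length_le (hbad : ω ∉ bad t M r i) {m : ℕ} (hm : m < M) {j : Site}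
    (hj : j ∈ nearby i ((M - 1 - m) * r)) {l : List Site} (hp : IsRingingPath ω t M m j l)
    (hl : l.length ≤ r + 1) : l.length ≤ r := by
  by_contra hlt
  exact hbad ⟨m, hm, j, nearby_stage_subset hm hj, l, by omega, hp⟩

lemma Admissible.mem_nearby {j : Site} {k : ℕ} (h : Admissible t M r i ω j (k + 1)) :
    j ∈ nearby i (M * r) := by
  obtain ⟨m, hm, -, j₀, hj₀, l, hl, hp⟩ := h k rfl
  refine mem_nearby_trans hj₀ (mem_nearby_of_isChain hp.chain hp.last) ?_
  rw [List.length_cons] at hl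
  calc (M - 1 - m) * r + l.length ≤ (M - 1 - m) * r + r := by omega
    _ = (M - 1 - m + 1) * r := by ring
    _ ≤ M * r := Nat.mul_le_mul_right r (by omega)

/-- A ring at a site where its window is entered is admissible: the path is that site alone. -/
lemma exists_path_of_entrance (hbad : ω ∉ bad t M r i) {m : ℕ} (hm : m < M) {j : Site}
    (hj : j ∈ nearby i ((M - 1 - m) * r)) {k : ℕ} (hk : ringTime (ω j) k ∈ window t M m) :
    ∃ j₀ ∈ nearby i ((M - 1 - m) * r), ∃ l : List Site, (j :: l).length ≤ r ∧
      IsRingingPath ω t M m j₀ (j :: l) := by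
  have hp : IsRingingPath ω t M m j [j] := ⟨by simp, by simp, by simp, by
    intro x hx
    rw [List.mem_singleton] at hx
    exact hx ▸ ⟨k, hk⟩⟩
  exact ⟨j, hj, [], hp.length_le hbad hm hj (by simp), hp⟩

/-- Going back one generation of updates, the ringing path is prolonged, or cut back where it
closes a loop, within a window, and a new path is begun whenever an earlier window is entered. -/
lemma Admissible.neighbour (ht : 0 ≤ t) (hM : 0 < M) (hreg : ∀ x, IsRegular (ω x))
    (hbad : ω ∉ bad t M r i) {j : Site} {k : ℕ} (h : Admissible t M r i ω j (k + 1))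
    {j' : Site} (hj' : j' ∈ neighbours j) :
    Admissible t M r i ω j' (ringCount (ω j') (Set.Iio (ringTime (ω j) k))) := by
  intro k' hk'
  obtain ⟨m, hm, hwin, j₀, hj₀, l, hl, hp⟩ := h k rfl
  have hlt : ringTime (ω j') k' < ringTime (ω j) k :=
    ((hreg j').lt_ringCount_iff Set.Iio_subset_Iic_self (isLowerSet_Iio _) k').1 (by omega)
  obtain ⟨m', hm', hwin'⟩ := exists_mem_window ht hM ((hreg j').ringTime_pos k')
    (hlt.le.trans (window_le ht hm hwin))
  refine ⟨m', hm', hwin', ?_⟩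
  rcases (window_index_le ht hM hwin hwin' hlt).eq_or_lt with rfl | hmm
  · by_cases hmem : j' ∈ j :: l
    · obtain ⟨l₁, l₂, hl₂⟩ := List.append_of_mem hmem
      have hsuf : j' :: l₂ <:+ j :: l := ⟨l₁, hl₂.symm⟩
      refine ⟨j₀, hj₀, l₂, hsuf.length_le.trans hl, hp.chain.suffix hsuf,
        hp.nodup.sublist hsuf.sublist, ?_, fun x hx => hp.rings x (hsuf.subset hx)⟩
      have := hp.last
      rwa [hl₂, List.getLast?_append_of_ne_nil _ (by simp)] at this
    · have hp' : IsRingingPath ω t M m' j₀ (j' :: j :: l) := by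
        refine ⟨List.isChain_cons_cons.2 ⟨hj', hp.chain⟩,
          List.nodup_cons.2 ⟨hmem, hp.nodup⟩, ?_, ?_⟩
        · rw [List.getLast?_cons_cons]
          exact hp.last
        · intro x hx
          rcases List.mem_cons.1 hx with rfl | hx
          · exact ⟨k', hwin'⟩
          · exact hp.rings x hx
      exact ⟨j₀, hj₀, j :: l, hp'.length_le hbad hm hj₀ (by simpa using hl), hp'⟩
  · refine exists_path_of_entrance hbad hm' ?_ hwin'
    refine mem_nearby_trans hj₀ (mem_nearby_trans (mem_nearby_of_isChain hp.chain hp.last)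
      (mem_nearby_of_mem_neighbours hj') (T := r) (by simpa using hl)) ?_
    calc (M - 1 - m) * r + r = (M - 1 - m + 1) * r := by ring
      _ ≤ (M - 1 - m') * r := Nat.mul_le_mul_right r (by omega)

lemma admissible_self (ht : 0 ≤ t) (hM : 0 < M) (hreg : ∀ x, IsRegular (ω x))
    (hbad : ω ∉ bad t M r i) : Admissible t M r i ω i (ringCount (ω i) (Set.Iic t)) := by
  intro k hk
  have hle : ringTime (ω i) k ≤ t :=
    ((hreg i).lt_ringCount_iff subset_rfl (isLowerSet_Iic _) k).1 (by omega)
  obtain ⟨m, hm, hwin⟩ := exists_mem_window ht hM ((hreg i).ringTime_pos k)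
    (hle.trans (le_add_of_nonneg_right zero_le_one))
  exact ⟨m, hm, hwin, exists_path_of_entrance hbad hm (mem_nearby_self _ _) hwin⟩

/-- The admissible updates do not see the noise far from `i`. -/
lemma spinAfter_congr_of_admissible (β : ℝ) (η : Config) (ht : 0 ≤ t) (hM : 0 < M)
    (hreg : ∀ x, IsRegular (ω x)) (hbad : ω ∉ bad t M r i) {ω' : Noise}
    (hin : ∀ x ∈ nearby i (M * r), ω' x = ω x)
    (hout : ∀ x ∉ nearby i (M * r), ∀ k, t + 1 < ringTime (ω' x) k) (n : ℕ) {j : Site} {k : ℕ}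
    (h : Admissible t M r i ω j k) : spinAfter β η ω' n j k = spinAfter β η ω n j k := by
  induction n generalizing j k with
  | zero => simp [spinAfter]
  | succ n ih =>
    cases k with
    | zero => simp [spinAfter]
    | succ k =>
      have hj := hin j h.mem_nearby
      rw [spinAfter, spinAfter, hj]
      refine heatBath_congr β _ fun j' hj' => ?_
      have hadm := h.neighbour ht hM hreg hbad hj'
      by_cases hmem : j' ∈ nearby i (M * r)
      · rw [hin j' hmem]
        exact ih hadm
      · have h0 : ringCount (ω j') (Set.Iio (ringTime (ω j) k)) = 0 := by
          by_contra hne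
          obtain ⟨k', hk'⟩ := Nat.exists_eq_succ_of_ne_zero hne
          rw [hk'] at hadm
          exact hmem hadm.mem_nearby
        have h0' : ringCount (ω' j') (Set.Iio (ringTime (ω j) k)) = 0 := by
          obtain ⟨m, hm, hwin, -⟩ := h k rfl
          have : {k' : ℕ | ringTime (ω' j') k' ∈ Set.Iio (ringTime (ω j) k)} = ∅ := by
            ext k'
            have := hout j' hmem k'
            simpa using (window_le ht hm hwin).trans this.le
          rw [ringCount, this, Set.ncard_empty]
        rw [h0, h0']
        rw [h0] at hadm
        exact ih hadm

/-- Each generation of admissible updates uses up one of the finitely many rings near `i`, so that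
the spin ceases to depend on the number of generations. -/
lemma spinAfter_succ_of_admissible (β : ℝ) (η : Config) (ht : 0 ≤ t) (hM : 0 < M)
    (hreg : ∀ x, IsRegular (ω x)) (hbad : ω ∉ bad t M r i) (n : ℕ) {j : Site} {k : ℕ}
    (h : Admissible t M r i ω j k)
    (hn : ∀ k', k = k' + 1 →
      ∑ x ∈ nearby i (M * r), ringCount (ω x) (Set.Iio (ringTime (ω j) k')) < n) :
    spinAfter β η ω (n + 1) j k = spinAfter β η ω n j k := by
  induction n generalizing j k with
  | zero =>
    cases k with
    | zero => simp [spinAfter]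
    | succ k => exact absurd (hn k rfl) (Nat.not_lt_zero _)
  | succ n ih =>
    cases k with
    | zero => simp [spinAfter]
    | succ k =>
      rw [spinAfter, spinAfter]
      refine heatBath_congr β _ fun j' hj' => ?_
      have hadm := h.neighbour ht hM hreg hbad hj'
      refine ih hadm fun k' hk' => ?_
      have hcount := (hreg j').lt_ringCount_iff (s := ringTime (ω j) k) Set.Iio_subset_Iic_self
        (isLowerSet_Iio _) k'
      have hlt : ringTime (ω j') k' < ringTime (ω j) k := hcount.1 (by omega)
      have hmem : j' ∈ nearby i (M * r) := by
        rw [hk'] at hadm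
        exact hadm.mem_nearby
      have hstrict : ∑ x ∈ nearby i (M * r), ringCount (ω x) (Set.Iio (ringTime (ω j') k'))
          < ∑ x ∈ nearby i (M * r), ringCount (ω x) (Set.Iio (ringTime (ω j) k)) := by
        refine Finset.sum_lt_sum (fun x _ => (hreg x).ringCount_Iio_mono hlt.le) ⟨j', hmem, ?_⟩
        have h1 : ¬ k' < ringCount (ω j') (Set.Iio (ringTime (ω j') k')) := by
          rw [(hreg j').lt_ringCount_iff Set.Iio_subset_Iic_self (isLowerSet_Iio _)]
          simp
        omega
      have := hn k rfl
      omega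

lemma state_congr {β t : ℝ} {η η' : Config} {ω ω' : Noise} {i i' : Site}
    (h : ∀ n, spinAfter β η ω n i (ringCount (ω i) (Set.Iic t))
      = spinAfter β η' ω' n i' (ringCount (ω' i') (Set.Iic t))) :
    state β t η ω i = state β t η' ω' i' := by
  have h' : (∀ᶠ n in atTop, spinAfter β η ω n i (ringCount (ω i) (Set.Iic t)) = 1) ↔
      ∀ᶠ n in atTop, spinAfter β η' ω' n i' (ringCount (ω' i') (Set.Iic t)) = 1 := by simp only [h]
  unfold state
  split_ifs with h1 h2 h2
  · rfl
  · exact absurd (h'.1 h1) h2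
  · exact absurd (h'.2 h2) h1
  · rfl

lemma state_eq_of_eventually {β t : ℝ} {η : Config} {ω : Noise} {i : Site} {s : ℤˣ}
    (h : ∀ᶠ n in atTop, spinAfter β η ω n i (ringCount (ω i) (Set.Iic t)) = s) :
    state β t η ω i = s := by
  unfold state
  split_ifs with h'
  · obtain ⟨n, h1, h2⟩ := (h.and h').exists
    rw [← h1, h2]
  · rcases Int.units_eq_one_or s with rfl | rfl
    · exact absurd h h'
    · rfl

lemma eventually_spinAfter_eq_state (β : ℝ) (η : Config) (ht : 0 ≤ t) (hM : 0 < M)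
    (hreg : ∀ x, IsRegular (ω x)) (hbad : ω ∉ bad t M r i) :
    ∀ᶠ n in atTop, spinAfter β η ω n i (ringCount (ω i) (Set.Iic t)) = state β t η ω i := by
  set k := ringCount (ω i) (Set.Iic t) with hk
  set N := ∑ x ∈ nearby i (M * r), ringCount (ω x) (Set.Iio (ringTime (ω i) (k - 1))) with hN
  have hstep : ∀ n > N, spinAfter β η ω (n + 1) i k = spinAfter β η ω n i k := fun n hn =>
    spinAfter_succ_of_admissible β η ht hM hreg hbad n (admissible_self ht hM hreg hbad)
      fun k' hk' => by
        have : k - 1 = k' := by omega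
        rwa [hN, this] at hn
  have hconst : ∀ n ≥ N + 1, spinAfter β η ω n i k = spinAfter β η ω (N + 1) i k := by
    intro n hn
    induction n, hn using Nat.le_induction with
    | base => rfl
    | succ n hn ih => rw [hstep n hn, ih]
  have hev : ∀ᶠ n in atTop, spinAfter β η ω n i k = spinAfter β η ω (N + 1) i k :=
    eventually_atTop.2 ⟨N + 1, hconst⟩
  rwa [state_eq_of_eventually hev]

lemma state_congr_of_notMem_bad (β : ℝ) (η : Config) (ht : 0 ≤ t) (hM : 0 < M)
    (hreg : ∀ x, IsRegular (ω x)) (hbad : ω ∉ bad t M r i) {ω' : Noise}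
    (hin : ∀ x ∈ nearby i (M * r), ω' x = ω x)
    (hout : ∀ x ∉ nearby i (M * r), ∀ k, t + 1 < ringTime (ω' x) k) :
    state β t η ω' i = state β t η ω i := by
  refine state_congr fun n => ?_
  rw [hin i (mem_nearby_self _ _)]
  exact spinAfter_congr_of_admissible β η ht hM hreg hbad hin hout n
    (admissible_self ht hM hreg hbad)

end Deterministic

/-! ### Symmetries of the dynamics -/

lemma ae_noiseLaw_forall {p : Clock → Prop} (h : ∀ᵐ w ∂clockLaw, p w) :
    ∀ᵐ ω ∂noiseLaw, ∀ i, p (ω i) :=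
  ae_all_iff.2 fun i =>
    (measurePreserving_eval_infinitePi (fun _ : Site => clockLaw) i).quasiMeasurePreserving.ae h

lemma ae_exists_notMem_bad {t : ℝ} {M : ℕ} (h : ∀ m < M, clockLaw (ringing t M m) ≤ 8⁻¹) :
    ∀ᵐ ω ∂noiseLaw, ∀ i, ∃ r, ω ∉ bad t M r i := by
  obtain ⟨C, -, hC⟩ := exists_noiseLaw_bad_le h
  refine ae_all_iff.2 fun i => ?_
  have hlim : Tendsto (fun r : ℕ => C / ((r : ℝ) + 1) ^ 4) atTop (𝓝 0) :=
    tendsto_const_nhds.div_atTop ((tendsto_pow_atTop (by norm_num)).comp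
      (tendsto_atTop_add_const_right _ 1 tendsto_natCast_atTop_atTop))
  have h0 : noiseLaw.real {ω | ¬ ∃ r, ω ∉ bad t M r i} ≤ 0 :=
    ge_of_tendsto' hlim fun r => (measureReal_mono fun ω hω => by
      simp only [not_exists, not_not, Set.mem_ofPred_eq] at hω
      exact hω r).trans (hC r i)
  rw [ae_iff]
  exact (measureReal_eq_zero_iff).1 (le_antisymm h0 measureReal_nonneg)

/-- Translation of the noise. -/
def shiftNoise (v : Site) (ω : Noise) : Noise := fun i => ω (i - v)

/-- The reflection `x ↦ 1 - x` of all marks. -/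
def flipNoise (ω : Noise) : Noise := fun i k => ((ω i k).1, unitInterval.symm (ω i k).2)

lemma measurePreserving_shiftNoise (v : Site) :
    MeasurePreserving (shiftNoise v) noiseLaw noiseLaw := by
  refine ⟨measurable_pi_lambda _ fun i => measurable_pi_apply _, ?_⟩
  exact Measure.map_infinitePi_infinitePi_of_inj (P := fun _ : Site => clockLaw)
    (f := fun i => i - v) (sub_left_injective (b := v))

lemma measurePreserving_flipNoise : MeasurePreserving flipNoise noiseLaw noiseLaw := by
  have h1 : MeasurePreserving (Prod.map id unitInterval.symm)
      ((expMeasure 1).prod (volume : Measure unitInterval)) ((expMeasure 1).prod volume) :=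
    (MeasurePreserving.id _).prod unitInterval.measurePreserving_symm
  have h2 : MeasurePreserving (fun (w : Clock) k => Prod.map id unitInterval.symm (w k))
      clockLaw clockLaw := by
    refine ⟨by fun_prop, ?_⟩
    rw [clockLaw, Measure.infinitePi_map_pi _ fun _ => h1.measurable, h1.map_eq]
  refine ⟨measurable_pi_lambda _ fun i => h2.measurable.comp (measurable_pi_apply i), ?_⟩
  have := Measure.infinitePi_map_pi (fun _ : Site => clockLaw) (fun _ : Site => h2.measurable)
  rw [h2.map_eq] at this
  exact this

lemma vadd_apply (v : Site) (σ : Config) (i : Site) : (v +ᵥ σ) i = σ (i - v) := rfl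

lemma heatBath_vadd (β : ℝ) (v : Site) (σ : Config) (i : Site) (x : unitInterval) :
    heatBath β (v +ᵥ σ) i x = heatBath β σ (i - v) x := by
  have hs : ∑ j ∈ neighbours i, spin (v +ᵥ σ) j = ∑ j ∈ neighbours (i - v), spin σ j := by
    refine Finset.sum_nbij' (fun j => j - v) (fun j => j + v) ?_ ?_ ?_ ?_ ?_
    · intro j hj
      rw [mem_neighbours] at *
      rcases hj with rfl | rfl | rfl | rfl
      exacts [Or.inl (by abel), Or.inr (Or.inl (by abel)), Or.inr (Or.inr (Or.inl (by abel))),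
        Or.inr (Or.inr (Or.inr (by abel)))]
    · intro j hj
      rw [mem_neighbours] at *
      rcases hj with rfl | rfl | rfl | rfl
      exacts [Or.inl (by abel), Or.inr (Or.inl (by abel)), Or.inr (Or.inr (Or.inl (by abel))),
        Or.inr (Or.inr (Or.inr (by abel)))]
    · simp
    · simp
    · intro j _
      rfl
  have hp : plusProb β (v +ᵥ σ) i = plusProb β σ (i - v) := by rw [plusProb, plusProb, hs]
  rw [heatBath, heatBath, hp]

lemma spinAfter_vadd (β : ℝ) (v : Site) (η : Config) (ω : Noise) (n : ℕ) (i : Site) (k : ℕ) :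
    spinAfter β (v +ᵥ η) (shiftNoise v ω) n i k = spinAfter β η ω n (i - v) k := by
  induction n generalizing i k with
  | zero => rfl
  | succ n ih =>
    cases k with
    | zero => rfl
    | succ k =>
      rw [spinAfter, spinAfter, ← heatBath_vadd]
      simp only [ih]
      rfl

lemma state_vadd (β t : ℝ) (v : Site) (η : Config) (ω : Noise) :
    state β t (v +ᵥ η) (shiftNoise v ω) = v +ᵥ state β t η ω := by
  funext i
  rw [vadd_apply]
  exact state_congr fun n => spinAfter_vadd β v η ω n i _

lemma plusProb_spinFlip (β : ℝ) (σ : Config) (i : Site) :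
    plusProb β (spinFlip σ) i = 1 - plusProb β σ i := by
  have hs : ∑ j ∈ neighbours i, spin (spinFlip σ) j = -∑ j ∈ neighbours i, spin σ j := by
    rw [← Finset.sum_neg_distrib]
    exact Finset.sum_congr rfl fun j _ => by simp [spin, spinFlip]
  rw [plusProb, plusProb, hs, mul_neg, neg_neg, eq_sub_iff_add_eq, add_comm (Real.exp (-_)),
    ← add_div, add_comm (Real.exp (-_)), div_self]
  positivity

lemma heatBath_spinFlip {β : ℝ} {σ : Config} {i : Site} {v : unitInterval}
    (h : (v : ℝ) ≠ plusProb β σ i) :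
    heatBath β (spinFlip σ) i (unitInterval.symm v) = -heatBath β σ i v := by
  rw [heatBath, heatBath, plusProb_spinFlip, unitInterval.coe_symm_eq]
  rcases h.lt_or_gt with h | h
  · rw [if_neg (by linarith), if_pos h.le]
  · rw [if_pos (by linarith), if_neg (by linarith), neg_neg]

/-- The conditional probabilities take countably many values, so no mark ever hits one. -/
lemma ae_mark_ne_plusProb (β : ℝ) :
    ∀ᵐ ω ∂noiseLaw, ∀ i k σ j, ((ω i k).2 : ℝ) ≠ plusProb β σ j := by
  have hcount : (Set.range fun p : Config × Site => plusProb β p.1 p.2).Countable := by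
    refine (Set.countable_range fun z : ℤ =>
      Real.exp (β * z) / (Real.exp (β * z) + Real.exp (-(β * z)))).mono ?_
    rintro _ ⟨⟨σ, i⟩, rfl⟩
    refine ⟨∑ j ∈ neighbours i, (σ j : ℤ), ?_⟩
    simp [plusProb, spin]
  have hnull : ∀ᵐ v : unitInterval ∂volume, ∀ σ j, (v : ℝ) ≠ plusProb β σ j := by
    rw [ae_iff]
    have hpre : (((↑) : unitInterval → ℝ) ⁻¹'
        Set.range fun p : Config × Site => plusProb β p.1 p.2).Countable :=
      hcount.preimage Subtype.val_injective
    refine measure_mono_null ?_ (hpre.measure_zero volume)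
    intro v hv
    simp only [not_forall, not_not, Set.mem_ofPred_eq] at hv
    obtain ⟨σ, j, h⟩ := hv
    exact ⟨(σ, j), h.symm⟩
  have hclock : ∀ᵐ w ∂clockLaw, ∀ k σ j, ((w k).2 : ℝ) ≠ plusProb β σ j := by
    refine ae_all_iff.2 fun k => ?_
    have hm : Measurable fun w : Clock => (w k).2 := by fun_prop
    rw [← map_mark k] at hnull
    exact ae_of_ae_map hm.aemeasurable hnull
  exact ae_noiseLaw_forall hclock

lemma spinAfter_spinFlip {β : ℝ} {ω : Noise}
    (hω : ∀ i k σ j, ((ω i k).2 : ℝ) ≠ plusProb β σ j) (η : Config) (n : ℕ) (i : Site) (k : ℕ) :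
    spinAfter β (spinFlip η) (flipNoise ω) n i k = -spinAfter β η ω n i k := by
  induction n generalizing i k with
  | zero => rfl
  | succ n ih =>
    cases k with
    | zero => rfl
    | succ k =>
      rw [spinAfter, spinAfter, ← heatBath_spinFlip (hω _ _ _ _)]
      simp only [ih]
      rfl

/-- The flip symmetry needs the almost sure convergence of the construction: where it fails, the
spin is `-1` by convention for all initial conditions. -/
lemma ae_state_spinFlip {t : ℝ} (ht : 0 ≤ t) (β : ℝ) (η : Config) :
    ∀ᵐ ω ∂noiseLaw, state β t (spinFlip η) (flipNoise ω) = spinFlip (state β t η ω) := by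
  obtain ⟨M, hM, hle⟩ := exists_clockLaw_ringing_le ht
  filter_upwards [ae_noiseLaw_forall ae_isRegular, ae_exists_notMem_bad hle,
    ae_mark_ne_plusProb β] with ω hreg hbad hmark
  funext i
  obtain ⟨r, hr⟩ := hbad i
  refine state_eq_of_eventually
    ((eventually_spinAfter_eq_state β η ht hM hreg hr).mono fun n hn => ?_)
  have : ringCount (flipNoise ω i) (Set.Iic t) = ringCount (ω i) (Set.Iic t) := rfl
  rw [this, spinAfter_spinFlip hmark, hn]
  rfl

/-! ### The law at a fixed time -/

lemma measurable_state_right (β t : ℝ) (η : Config) : Measurable (state β t η) :=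
  (measurable_state β t).comp measurable_prodMk_left

lemma lawAt_eq_map (β t : ℝ) (η : Config) : lawAt β t η = noiseLaw.map (state β t η) :=
  Measure.dirac_bind (Kernel.measurable _) η

instance isProbabilityMeasure_lawAt (β t : ℝ) (η : Config) :
    IsProbabilityMeasure (lawAt β t η) := by
  rw [lawAt_eq_map]
  exact Measure.isProbabilityMeasure_map (measurable_state_right β t η).aemeasurable

lemma measurable_vadd_config (v : Site) : Measurable fun σ : Config => v +ᵥ σ :=
  measurable_pi_lambda _ fun i => measurable_pi_apply (i - v)

lemma measurable_spinFlip : Measurable spinFlip :=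
  measurable_pi_lambda _ fun i =>
    (Measurable.of_discrete (f := fun x : ℤˣ => -x)).comp (measurable_pi_apply i)

lemma map_vadd_lawAt (β t : ℝ) (v : Site) (η : Config) :
    (lawAt β t η).map (fun σ => v +ᵥ σ) = lawAt β t (v +ᵥ η) := by
  rw [lawAt_eq_map, lawAt_eq_map, Measure.map_map (measurable_vadd_config v)
    (measurable_state_right β t η)]
  nth_rw 2 [← (measurePreserving_shiftNoise v).map_eq]
  rw [Measure.map_map (measurable_state_right β t _) (measurePreserving_shiftNoise v).measurable]
  congr 1
  funext ω
  exact (state_vadd β t v η ω).symm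

lemma map_spinFlip_lawAt {t : ℝ} (ht : 0 ≤ t) (β : ℝ) (η : Config) :
    (lawAt β t η).map spinFlip = lawAt β t (spinFlip η) := by
  rw [lawAt_eq_map, lawAt_eq_map, Measure.map_map measurable_spinFlip
    (measurable_state_right β t η)]
  nth_rw 2 [← measurePreserving_flipNoise.map_eq]
  rw [Measure.map_map (measurable_state_right β t _) measurePreserving_flipNoise.measurable]
  exact Measure.map_congr ((ae_state_spinFlip ht β η).mono fun ω h => h.symm)

/-- The mean spin at a site at time `t`. -/
noncomputable def meanSpin (β t : ℝ) (η : Config) (a : Site) : ℝ := ∫ σ, spin σ a ∂(lawAt β t η)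

lemma meanSpin_vadd (β t : ℝ) (v : Site) (η : Config) (a : Site) :
    meanSpin β t (v +ᵥ η) a = meanSpin β t η (a - v) := by
  rw [meanSpin, ← map_vadd_lawAt, integral_map (measurable_vadd_config v).aemeasurable
    (measurable_spin a).aestronglyMeasurable]
  rfl

lemma meanSpin_spinFlip {t : ℝ} (ht : 0 ≤ t) (β : ℝ) (η : Config) (a : Site) :
    meanSpin β t (spinFlip η) a = -meanSpin β t η a := by
  rw [meanSpin, ← map_spinFlip_lawAt ht, integral_map measurable_spinFlip.aemeasurable
    (measurable_spin a).aestronglyMeasurable, meanSpin, ← integral_neg]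
  simp [spin, spinFlip]

lemma IsAntiperiodic.meanSpin_add {L : AddSubgroup Site} {u : Site} {η : Config}
    (h : IsAntiperiodic L u η) {t : ℝ} (ht : 0 ≤ t) (β : ℝ) (a : Site) :
    meanSpin β t η (a + u) = -meanSpin β t η a := by
  have h' := meanSpin_spinFlip ht β η (a + u)
  rw [← h.2, meanSpin_vadd, add_sub_cancel_right] at h'
  linarith

lemma IsAntiperiodic.meanSpin_add_of_mem {L : AddSubgroup Site} {u : Site} {η : Config}
    (h : IsAntiperiodic L u η) (β t : ℝ) {l : Site} (hl : l ∈ L) (a : Site) :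
    meanSpin β t η (a + l) = meanSpin β t η a := by
  conv_lhs => rw [← h.1 l hl]
  rw [meanSpin_vadd, add_sub_cancel_right]

/-! ### Ergodicity -/

lemma indepFun_restrict_noiseLaw {F G : Finset Site} (h : Disjoint F G) :
    IndepFun (F.restrict : Noise → F → Clock) (G.restrict : Noise → G → Clock) noiseLaw := by
  have hind : iIndepFun (fun (i : Site) (ω : Noise) => ω i) noiseLaw :=
    iIndepFun_infinitePi (P := fun _ : Site => clockLaw) (X := fun _ => id) fun _ => measurable_id
  exact hind.indepFun_finset F G h fun i => measurable_pi_apply i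

lemma abs_measureReal_sub_le {Ω : Type*} [MeasurableSpace Ω] (μ : Measure Ω) [IsFiniteMeasure μ]
    {s t d : Set Ω} (h : symmDiff s t ⊆ d) : |μ.real s - μ.real t| ≤ μ.real d := by
  have h1 : μ.real s ≤ μ.real t + μ.real d := by
    refine (measureReal_mono fun x hx => ?_).trans (measureReal_union_le t d)
    by_cases hxt : x ∈ t
    · exact Or.inl hxt
    · exact Or.inr (h (Or.inl ⟨hx, hxt⟩))
  have h2 : μ.real t ≤ μ.real s + μ.real d := by
    refine (measureReal_mono fun x hx => ?_).trans (measureReal_union_le s d)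
    by_cases hxs : x ∈ s
    · exact Or.inl hxs
    · exact Or.inr (h (Or.inr ⟨hx, hxs⟩))
  rw [abs_sub_le_iff]
  constructor <;> linarith

lemma exists_mem_disjoint_image_sub {L : AddSubgroup Site} (hL : (L : Set Site).Infinite)
    (F : Finset Site) : ∃ l ∈ L, Disjoint F (F.image (· - l)) := by
  obtain ⟨l, hl, hlF⟩ := hL.exists_notMem_finset (Finset.image₂ (· - ·) F F)
  refine ⟨l, hl, Finset.disjoint_left.2 fun x hx hx' => hlF ?_⟩
  obtain ⟨y, hy, rfl⟩ := Finset.mem_image.1 hx'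
  exact Finset.mem_image₂.2 ⟨y, hy, y - l, hx, by abel⟩

/-- A cylinder event is independent of a far translate of itself. -/
lemma noiseLaw_inter_shiftNoise {F : Finset Site} {S : Set (F → Clock)} (hS : MeasurableSet S)
    {l : Site} (hl : Disjoint F (F.image (· - l))) :
    noiseLaw (cylinder F S ∩ shiftNoise l ⁻¹' cylinder F S)
      = noiseLaw (cylinder F S) * noiseLaw (cylinder F S) := by
  set T : Set (F.image (· - l) → Clock) :=
    {y | (fun x : F => y ⟨x.1 - l, Finset.mem_image_of_mem _ x.2⟩) ∈ S} with hT
  have hTm : MeasurableSet T :=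
    (show Measurable fun (y : F.image (· - l) → Clock) (x : F) =>
      y ⟨x.1 - l, Finset.mem_image_of_mem _ x.2⟩ by fun_prop) hS
  have hpre : shiftNoise l ⁻¹' cylinder F S = (F.image (· - l)).restrict ⁻¹' T := rfl
  have hind :=
    indepFun_iff_measure_inter_preimage_eq_mul.1 (indepFun_restrict_noiseLaw hl) S T hS hTm
  rw [← hpre, (measurePreserving_shiftNoise l).measure_preimage
    (MeasurableSet.cylinder F hS).nullMeasurableSet] at hind
  exact hind

/-- The zero-one law for the noise under an infinite group of translations: an invariant event is
approximated by cylinder events, hence it is independent of itself. -/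
lemma noiseLaw_eq_zero_or_one_of_invariant {L : AddSubgroup Site} (hL : (L : Set Site).Infinite)
    {s : Set Noise} (hs : MeasurableSet s)
    (hinv : ∀ l ∈ L, shiftNoise l ⁻¹' s =ᵐ[noiseLaw] s) :
    noiseLaw.real s = 0 ∨ noiseLaw.real s = 1 := by
  have hdense : noiseLaw.MeasureDense (measurableCylinders fun _ : Site => Clock) :=
    Measure.MeasureDense.of_generateFrom_isSetAlgebra_finite noiseLaw
      isSetAlgebra_measurableCylinders generateFrom_measurableCylinders.symm
  set p := noiseLaw.real s with hp
  have hp0 : 0 ≤ p := measureReal_nonneg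
  have hp1 : p ≤ 1 := measureReal_le_one
  have hclose : ∀ ε > 0, |p - p * p| ≤ 4 * ε := by
    intro ε hε
    obtain ⟨c, hc, hsc⟩ := hdense.approx s hs (measure_ne_top _ _) ε hε
    obtain ⟨F, S, hS, rfl⟩ := (mem_measurableCylinders _).1 hc
    obtain ⟨l, hl, hdisj⟩ := exists_mem_disjoint_image_sub hL F
    have hcm : MeasurableSet (cylinder F S) := hdense.measurable _ hc
    have hmp := measurePreserving_shiftNoise l
    have hε' : noiseLaw.real (symmDiff s (cylinder F S)) ≤ ε :=
      ENNReal.toReal_le_of_le_ofReal hε.le hsc.le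
    have hshift : noiseLaw.real (shiftNoise l ⁻¹' symmDiff s (cylinder F S)) ≤ ε := by
      rwa [measureReal_def, hmp.measure_preimage (hs.symmDiff hcm).nullMeasurableSet]
    have h1 : noiseLaw.real (s ∩ shiftNoise l ⁻¹' s) = p := by
      have : (s ∩ shiftNoise l ⁻¹' s : Set Noise) =ᵐ[noiseLaw] (s ∩ s : Set Noise) :=
        (ae_eq_refl s).inter (hinv l hl)
      rw [measureReal_congr this, Set.inter_self]
    have h2 : noiseLaw.real (cylinder F S ∩ shiftNoise l ⁻¹' cylinder F S)
        = noiseLaw.real (cylinder F S) * noiseLaw.real (cylinder F S) := by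
      rw [measureReal_def, noiseLaw_inter_shiftNoise hS hdisj, ENNReal.toReal_mul]
      rfl
    have h3 : |noiseLaw.real (s ∩ shiftNoise l ⁻¹' s)
        - noiseLaw.real (cylinder F S ∩ shiftNoise l ⁻¹' cylinder F S)| ≤ ε + ε := by
      refine (abs_measureReal_sub_le noiseLaw (d := symmDiff s (cylinder F S)
        ∪ shiftNoise l ⁻¹' symmDiff s (cylinder F S)) ?_).trans
        ((measureReal_union_le _ _).trans (add_le_add hε' hshift))
      intro ω
      simp only [Set.mem_symmDiff, Set.mem_inter_iff, Set.mem_union, Set.mem_preimage]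
      tauto
    have h4 : |p - noiseLaw.real (cylinder F S)| ≤ ε :=
      (abs_measureReal_sub_le noiseLaw subset_rfl).trans hε'
    rw [h1, h2] at h3
    have hq0 : 0 ≤ noiseLaw.real (cylinder F S) := measureReal_nonneg
    have hq1 : noiseLaw.real (cylinder F S) ≤ 1 := measureReal_le_one
    rw [abs_le] at *
    constructor <;> nlinarith
  have hzero : |p - p * p| ≤ 0 := by
    refine le_of_forall_pos_le_add fun ε hε => ?_
    have := hclose (ε / 4) (by positivity)
    linarith
  have hmul : p * (1 - p) = 0 := by
    have := abs_nonpos_iff.1 hzero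
    linarith
  rcases mul_eq_zero.1 hmul with h | h
  · exact Or.inl h
  · exact Or.inr (by linarith)

lemma infinite_of_finiteIndex {L : AddSubgroup Site} (hL : L.FiniteIndex) :
    (L : Set Site).Infinite := by
  intro hfin
  have h1 : Finite L := hfin
  exact not_finite_iff_infinite.2 (inferInstance : Infinite Site)
    ((AddSubgroup.finite_iff_finite_and_finiteIndex L).2 ⟨h1, hL⟩)

/-- The law at time `t` is a factor of the noise, by a map that commutes with the translations under
which the initial condition is invariant. -/
lemma ergodicVAdd_lawAt (β t : ℝ) {η : Config} {L : AddSubgroup Site} (hL : L.FiniteIndex)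
    (hη : ∀ l ∈ L, l +ᵥ η = η) : ErgodicVAdd L Config (lawAt β t η) where
  measure_preimage_vadd := by
    intro l s hs
    have := map_vadd_lawAt β t l.1 η
    rw [hη l.1 l.2] at this
    nth_rw 2 [← this]
    rw [Measure.map_apply (measurable_vadd_config l.1) hs]
    rfl
  aeconst_of_forall_preimage_vadd_ae_eq := by
    intro s hs hinv
    have hst := measurable_state_right β t η
    have h01 := noiseLaw_eq_zero_or_one_of_invariant (infinite_of_finiteIndex hL) (hst hs) ?_
    · have hreal : (lawAt β t η).real s = noiseLaw.real (state β t η ⁻¹' s) := by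
        rw [measureReal_def, measureReal_def, lawAt_eq_map, Measure.map_apply hst hs]
      rw [← hreal] at h01
      rw [eventuallyConst_set]
      rcases h01 with h | h
      · right
        rw [measureReal_eq_zero_iff] at h
        exact measure_eq_zero_iff_ae_notMem.1 h
      · left
        refine (mem_ae_iff_prob_eq_one hs).2 ?_
        rw [measureReal_def, ENNReal.toReal_eq_one_iff] at h
        exact h
    · intro l hl
      have h := hinv ⟨l, hl⟩
      rw [lawAt_eq_map] at h
      have h' := ae_eq_comp hst.aemeasurable h
      refine Filter.EventuallyEq.trans (Eq.eventuallyEq ?_) h'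
      funext ω
      have := state_vadd β t l η ω
      rw [hη l hl] at this
      change (state β t η (shiftNoise l ω) ∈ s) = (l +ᵥ state β t η ω ∈ s)
      rw [this]

/-! ### Decay of correlations -/

/-- Bounded variables that agree with independent ones up to small probability are almost
uncorrelated. -/
lemma abs_covariance_le_of_indepFun_approx {Ω : Type*} [MeasurableSpace Ω] {μ : Measure Ω}
    [IsProbabilityMeasure μ] {X X' Y Y' : Ω → ℝ} (hX : Measurable X) (hX' : Measurable X')
    (hY : Measurable Y) (hY' : Measurable Y') (bX : ∀ ω, |X ω| ≤ 1) (bX' : ∀ ω, |X' ω| ≤ 1)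
    (bY : ∀ ω, |Y ω| ≤ 1) (bY' : ∀ ω, |Y' ω| ≤ 1) (hind : IndepFun Y Y' μ) {b : ℝ}
    (hb : μ.real {ω | X ω ≠ Y ω} ≤ b) (hb' : μ.real {ω | X' ω ≠ Y' ω} ≤ b) :
    |cov[X, X'; μ]| ≤ 8 * b := by
  have memLp : ∀ {Z : Ω → ℝ}, Measurable Z → (∀ ω, |Z ω| ≤ 1) → MemLp Z 2 μ := fun hZ bZ =>
    MemLp.of_bound hZ.aestronglyMeasurable 1 (ae_of_all _ bZ)
  have key : ∀ {Z W : Ω → ℝ} {s : Set Ω}, Measurable Z → Measurable W → (∀ ω, |Z ω| ≤ 1) →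
      (∀ ω, |W ω| ≤ 1) → MeasurableSet s → (∀ ω ∉ s, Z ω = W ω) →
      |μ[Z] - μ[W]| ≤ 2 * μ.real s := by
    intro Z W s hZ hW bZ bW hs h
    rw [← integral_sub ((memLp hZ bZ).integrable (by norm_num))
      ((memLp hW bW).integrable (by norm_num))]
    have hint : ∫ ω, s.indicator (fun _ => (2 : ℝ)) ω ∂μ = 2 * μ.real s := by
      rw [integral_indicator_const _ hs, smul_eq_mul, mul_comm]
    rw [← hint, ← Real.norm_eq_abs]
    refine norm_integral_le_of_norm_le ((integrable_const _).indicator hs) (ae_of_all _ fun ω => ?_)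
    by_cases hω : ω ∈ s
    · rw [Set.indicator_of_mem hω, Real.norm_eq_abs]
      have h1 := abs_le.1 (bZ ω)
      have h2 := abs_le.1 (bW ω)
      exact abs_le.2 ⟨by linarith, by linarith⟩
    · rw [Set.indicator_of_notMem hω, h ω hω, sub_self, norm_zero]
  have prod_le : ∀ {x y : ℝ}, |x| ≤ 1 → |y| ≤ 1 → |x * y| ≤ 1 := fun hx hy => by
    rw [abs_mul]
    exact mul_le_one₀ hx (abs_nonneg _) hy
  have hs : MeasurableSet {ω | X ω ≠ Y ω} := (measurableSet_eq_fun hX hY).compl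
  have hs' : MeasurableSet {ω | X' ω ≠ Y' ω} := (measurableSet_eq_fun hX' hY').compl
  have h1 : |μ[X] - μ[Y]| ≤ 2 * b :=
    (key hX hY bX bY hs fun ω hω => not_not.1 hω).trans (by linarith)
  have h2 : |μ[X'] - μ[Y']| ≤ 2 * b :=
    (key hX' hY' bX' bY' hs' fun ω hω => not_not.1 hω).trans (by linarith)
  have h3 : |μ[X * X'] - μ[Y * Y']| ≤ 4 * b := by
    refine (key (hX.mul hX') (hY.mul hY') (fun ω => prod_le (bX ω) (bX' ω))
      (fun ω => prod_le (bY ω) (bY' ω)) (hs.union hs') fun ω hω => ?_).trans ?_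
    · simp only [Set.mem_union, Set.mem_ofPred_eq, not_or, not_not] at hω
      simp [hω.1, hω.2]
    · linarith [measureReal_union_le (μ := μ) {ω | X ω ≠ Y ω} {ω | X' ω ≠ Y' ω}]
  have mean_le : ∀ {Z : Ω → ℝ}, (∀ ω, |Z ω| ≤ 1) → |μ[Z]| ≤ 1 := fun bZ => by
    have := norm_integral_le_of_norm_le_const (μ := μ) (C := 1)
      (ae_of_all _ fun ω => (Real.norm_eq_abs _).trans_le (bZ ω))
    simpa using this
  have h4 : |μ[X] * μ[X'] - μ[Y] * μ[Y']| ≤ 4 * b := by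
    have e : μ[X] * μ[X'] - μ[Y] * μ[Y']
        = μ[X] * (μ[X'] - μ[Y']) + (μ[X] - μ[Y]) * μ[Y'] := by ring
    rw [e]
    refine (abs_add_le _ _).trans ?_
    rw [abs_mul, abs_mul]
    have := mul_le_mul (mean_le bX) h2 (abs_nonneg _) zero_le_one
    have := mul_le_mul h1 (mean_le bY') (abs_nonneg _) ((abs_nonneg _).trans h1)
    linarith
  have h0 := hind.covariance_eq_zero (memLp hY bY) (memLp hY' bY')
  rw [covariance_eq_sub (memLp hY bY) (memLp hY' bY')] at h0
  rw [covariance_eq_sub (memLp hX bX) (memLp hX' bX')]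
  rw [abs_le] at *
  constructor <;> linarith

lemma abs_spin (σ : Config) (i : Site) : |spin σ i| = 1 := by
  rcases Int.units_eq_one_or (σ i) with h | h <;> simp [spin, h]

/-- The noise with all clocks outside a finite set of sites replaced by one that does not ring up to
time `t + 1`. -/
noncomputable def silence (t : ℝ) (F : Finset Site) (y : F → Clock) : Noise := by
  classical
  exact fun x => if h : x ∈ F then y ⟨x, h⟩ else fun _ => (t + 2, 0)

lemma measurable_silence (t : ℝ) (F : Finset Site) : Measurable (silence t F) := by
  refine measurable_pi_lambda _ fun x => ?_
  by_cases h : x ∈ F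
  · simp only [silence, h, dite_true]
    exact measurable_pi_apply _
  · simp only [silence, h, dite_false]
    exact measurable_const

lemma silence_restrict_of_mem {t : ℝ} {F : Finset Site} {x : Site} (h : x ∈ F) (ω : Noise) :
    silence t F (F.restrict ω) x = ω x := by
  simp [silence, h]

lemma lt_ringTime_silence {t : ℝ} (ht : 0 ≤ t) {F : Finset Site} {x : Site} (h : x ∉ F)
    (y : F → Clock) (k : ℕ) : t + 1 < ringTime (silence t F y x) k := by
  simp only [silence, h, dite_false, ringTime, Finset.sum_const, Finset.card_range, nsmul_eq_mul]
  push_cast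
  have : (0 : ℝ) ≤ k := Nat.cast_nonneg k
  nlinarith

/-- The spin at a site at time `t`, as a function of the noise. -/
noncomputable def spinAt (β t : ℝ) (η : Config) (i : Site) (ω : Noise) : ℝ :=
  spin (state β t η ω) i

lemma measurable_spinAt (β t : ℝ) (η : Config) (i : Site) : Measurable (spinAt β t η i) :=
  (measurable_spin i).comp (measurable_state_right β t η)

lemma memLp_spinAt (β t : ℝ) (η : Config) (i : Site) : MemLp (spinAt β t η i) 2 noiseLaw :=
  MemLp.of_bound (measurable_spinAt β t η i).aestronglyMeasurable 1
    (ae_of_all _ fun _ => (abs_spin _ _).le)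

/-- The approximation of the spin at `i` that sees the noise at distance at most `R` from `i`
only. -/
noncomputable def localSpinAt (β t : ℝ) (η : Config) (R : ℕ) (i : Site) (ω : Noise) : ℝ :=
  spinAt β t η i (silence t (nearby i R) ((nearby i R).restrict ω))

lemma measurable_localSpinAt (β t : ℝ) (η : Config) (R : ℕ) (i : Site) :
    Measurable (localSpinAt β t η R i) :=
  (measurable_spinAt β t η i).comp ((measurable_silence t _).comp (Finset.measurable_restrict _))

lemma indepFun_localSpinAt (β t : ℝ) (η : Config) {R : ℕ} {i j : Site}
    (h : Disjoint (nearby i R) (nearby j R)) :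
    IndepFun (localSpinAt β t η R i) (localSpinAt β t η R j) noiseLaw :=
  (indepFun_restrict_noiseLaw h).comp
    ((measurable_spinAt β t η i).comp (measurable_silence t _))
    ((measurable_spinAt β t η j).comp (measurable_silence t _))

lemma noiseLaw_spinAt_ne_le {t : ℝ} (ht : 0 ≤ t) {M : ℕ} (hM : 0 < M) (β : ℝ) (η : Config) (r : ℕ)
    (i : Site) : noiseLaw.real {ω | spinAt β t η i ω ≠ localSpinAt β t η (M * r) i ω}
      ≤ noiseLaw.real (bad t M r i) := by
  refine ENNReal.toReal_mono (measure_ne_top _ _) (measure_mono_ae ?_)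
  filter_upwards [ae_noiseLaw_forall ae_isRegular] with ω hreg hne
  by_contra hbad
  refine hne ?_
  rw [localSpinAt, spinAt, spinAt, spin, spin,
    state_congr_of_notMem_bad β η ht hM hreg hbad (fun x hx => silence_restrict_of_mem hx ω)
      fun x hx k => lt_ringTime_silence ht hx _ k]

lemma disjoint_nearby {i j : Site} {R : ℕ}
    (h : 2 * R < (j.1 - i.1).natAbs ∨ 2 * R < (j.2 - i.2).natAbs) :
    Disjoint (nearby i R) (nearby j R) := by
  refine Finset.disjoint_left.2 fun x hx hx' => ?_
  rw [mem_nearby] at hx hx'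
  omega

/-- A summable weight on the lattice that bounds the decay of correlations. -/
noncomputable def weight (v : Site) : ℝ :=
  1 / ((1 + |(v.1 : ℝ)|) ^ 2) * (1 / ((1 + |(v.2 : ℝ)|) ^ 2))

lemma weight_nonneg (v : Site) : 0 ≤ weight v := by
  unfold weight
  positivity

lemma summable_weight : Summable weight := by
  have h1 : Summable fun n : ℕ => 1 / (1 + (n : ℝ)) ^ 2 := by
    have := (summable_nat_add_iff 1).2 (Real.summable_one_div_nat_pow.2 one_lt_two)
    refine this.congr fun n => ?_
    push_cast
    rw [add_comm]
  have h2 : Summable fun n : ℤ => 1 / (1 + |(n : ℝ)|) ^ 2 := by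
    refine Summable.of_nat_of_neg ?_ ?_
    · simpa using h1
    · simpa using h1
  exact h2.mul_of_nonneg h2 (fun n => by positivity) (fun n => by positivity)

/-- The spins at two sites have covariance bounded by the weight of their difference: they agree
with independent spins off two improbable events, for a range that is a fixed fraction of the
distance. -/
lemma exists_abs_covariance_spinAt_le {t : ℝ} (ht : 0 ≤ t) (β : ℝ) (η : Config) :
    ∃ C : ℝ, 0 ≤ C ∧ ∀ i j : Site,
      |cov[spinAt β t η i, spinAt β t η j; noiseLaw]| ≤ C * weight (j - i) := by
  obtain ⟨M, hM, hle⟩ := exists_clockLaw_ringing_le ht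
  obtain ⟨B, hB0, hB⟩ := exists_noiseLaw_bad_le hle
  have bound : ∀ (i : Site) (ω : Noise), |spinAt β t η i ω| ≤ 1 := fun i ω => (abs_spin _ _).le
  refine ⟨8 * (B + 1) * (2 * M + 1) ^ 4, by positivity, fun i j => ?_⟩
  set N := max (j.1 - i.1).natAbs (j.2 - i.2).natAbs with hN
  have hw : 1 / ((N : ℝ) + 1) ^ 4 ≤ weight (j - i) := by
    have e1 : |((j - i).1 : ℝ)| ≤ N := by
      rw [← Int.cast_abs, Int.abs_eq_natAbs, Int.cast_natCast, Nat.cast_le]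
      exact le_max_left _ _
    have e2 : |((j - i).2 : ℝ)| ≤ N := by
      rw [← Int.cast_abs, Int.abs_eq_natAbs, Int.cast_natCast, Nat.cast_le]
      exact le_max_right _ _
    rw [weight, one_div_mul_one_div]
    refine one_div_le_one_div_of_le (by positivity) ?_
    calc (1 + |((j - i).1 : ℝ)|) ^ 2 * (1 + |((j - i).2 : ℝ)|) ^ 2
        ≤ (1 + (N : ℝ)) ^ 2 * (1 + (N : ℝ)) ^ 2 := by gcongr
      _ = ((N : ℝ) + 1) ^ 4 := by ring
  set r := N / (2 * M + 1) with hr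
  have hrN : (N : ℝ) + 1 ≤ (2 * M + 1) * (r + 1) := by
    have : N + 1 ≤ (2 * M + 1) * (r + 1) :=
      Nat.lt_mul_div_succ N (show 0 < 2 * M + 1 by omega)
    exact_mod_cast this
  have hdecay : 8 * ((B + 1) / ((r : ℝ) + 1) ^ 4)
      ≤ 8 * (B + 1) * (2 * M + 1) ^ 4 * weight (j - i) := by
    calc 8 * ((B + 1) / ((r : ℝ) + 1) ^ 4)
        = 8 * (B + 1) * (2 * M + 1) ^ 4 * (1 / ((2 * M + 1) * ((r : ℝ) + 1)) ^ 4) := by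
          field_simp
      _ ≤ 8 * (B + 1) * (2 * M + 1) ^ 4 * (1 / ((N : ℝ) + 1) ^ 4) := by gcongr
      _ ≤ 8 * (B + 1) * (2 * M + 1) ^ 4 * weight (j - i) := by gcongr
  refine le_trans ?_ hdecay
  rcases Nat.eq_zero_or_pos N with h0 | hpos
  -- At distance zero there is nothing to decouple; the covariance is at most `1`.
  · have hr0 : r = 0 := by rw [hr, h0, Nat.zero_div]
    have hone : |cov[spinAt β t η i, spinAt β t η j; noiseLaw]| ≤ 8 * 1 :=
      abs_covariance_le_of_indepFun_approx (Y := fun _ => 0) (Y' := fun _ => 0)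
        (measurable_spinAt β t η i) (measurable_spinAt β t η j) measurable_const measurable_const
        (bound i) (bound j) (by simp) (by simp) (indepFun_const_left 0 _)
        measureReal_le_one measureReal_le_one
    rw [hr0]
    norm_num
    linarith
  · have hdisj : Disjoint (nearby i (M * r)) (nearby j (M * r)) := by
      refine disjoint_nearby ?_
      have h1 : (2 * M + 1) * r ≤ N := Nat.mul_div_le N (2 * M + 1)
      have h2 : 2 * (M * r) + r ≤ N := by
        calc 2 * (M * r) + r = (2 * M + 1) * r := by ring
          _ ≤ N := h1
      have h3 : 2 * (M * r) < N := by
        rcases Nat.eq_zero_or_pos r with hr0 | hr0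
        · rw [hr0]
          simpa using hpos
        · omega
      exact lt_max_iff.1 h3
    have hbad : ∀ k : Site, noiseLaw.real
        {ω | spinAt β t η k ω ≠ localSpinAt β t η (M * r) k ω} ≤ (B + 1) / ((r : ℝ) + 1) ^ 4 := by
      intro k
      refine ((noiseLaw_spinAt_ne_le ht hM β η r k).trans (hB r k)).trans ?_
      gcongr
      linarith
    exact abs_covariance_le_of_indepFun_approx (measurable_spinAt β t η i)
      (measurable_spinAt β t η j) (measurable_localSpinAt β t η (M * r) i)
      (measurable_localSpinAt β t η (M * r) j) (bound i) (bound j) (fun ω => bound i _)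
      (fun ω => bound j _) (indepFun_localSpinAt β t η hdisj) (hbad i) (hbad j)

/-! ### The law of large numbers -/

lemma box_eq_nearby (n : ℕ) : box n = nearby 0 n := by
  simp [box, nearby]

lemma card_box (n : ℕ) : (box n).card = (2 * n + 1) ^ 2 := by
  rw [box_eq_nearby, card_nearby]

lemma sum_weight_sub_le (F : Finset Site) (i : Site) :
    ∑ j ∈ F, weight (j - i) ≤ ∑' v, weight v := by
  have : ∑ j ∈ F, weight (j - i) = ∑ v ∈ F.image (· - i), weight v :=
    (Finset.sum_image fun x _ y _ h => sub_left_injective h).symm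
  rw [this]
  exact summable_weight.sum_le_tsum _ fun v _ => weight_nonneg v

lemma exists_variance_magnetization_le {t : ℝ} (ht : 0 ≤ t) (β : ℝ) (η : Config) :
    ∃ K : ℝ, ∀ n : ℕ, Var[fun ω => magnetization n (state β t η ω); noiseLaw]
      ≤ K / (2 * (n : ℝ) + 1) ^ 2 := by
  obtain ⟨C, hC0, hC⟩ := exists_abs_covariance_spinAt_le ht β η
  refine ⟨C * ∑' v, weight v, fun n => ?_⟩
  have hcard : ((box n).card : ℝ) = (2 * (n : ℝ) + 1) ^ 2 := by
    rw [card_box]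
    push_cast
    rfl
  have hpos : (0 : ℝ) < (2 * (n : ℝ) + 1) ^ 2 := by positivity
  have hmag : (fun ω => magnetization n (state β t η ω))
      = fun ω => ((box n).card : ℝ)⁻¹ * (∑ i ∈ box n, spinAt β t η i ω) := by
    funext ω
    rw [magnetization, div_eq_inv_mul]
    rfl
  have hsum : Var[fun ω => ∑ i ∈ box n, spinAt β t η i ω; noiseLaw]
      ≤ (box n).card * (C * ∑' v, weight v) := by
    rw [variance_fun_sum' fun i _ => memLp_spinAt β t η i, ← nsmul_eq_mul, ← Finset.sum_const]
    refine Finset.sum_le_sum fun i _ => ?_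
    calc ∑ j ∈ box n, cov[spinAt β t η i, spinAt β t η j; noiseLaw]
        ≤ ∑ j ∈ box n, C * weight (j - i) :=
          Finset.sum_le_sum fun j _ => (le_abs_self _).trans (hC i j)
      _ ≤ C * ∑' v, weight v := by
          rw [← Finset.mul_sum]
          exact mul_le_mul_of_nonneg_left (sum_weight_sub_le _ _) hC0
  rw [hmag, variance_const_mul, hcard]
  rw [hcard] at hsum
  calc ((2 * (n : ℝ) + 1) ^ 2)⁻¹ ^ 2 * Var[fun ω => ∑ i ∈ box n, spinAt β t η i ω; noiseLaw]
      ≤ ((2 * (n : ℝ) + 1) ^ 2)⁻¹ ^ 2 * ((2 * (n : ℝ) + 1) ^ 2 * (C * ∑' v, weight v)) := by gcongr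
    _ = C * (∑' v, weight v) / (2 * (n : ℝ) + 1) ^ 2 := by field_simp

/-- If the variances are summable, then so are almost surely the squares of the deviations from the
means. -/
lemma ae_tendsto_sub_mean_of_summable_variance {Ω : Type*} [MeasurableSpace Ω] {μ : Measure Ω}
    [IsProbabilityMeasure μ] {X : ℕ → Ω → ℝ} (hm : ∀ n, Measurable (X n))
    (hX : ∀ n, MemLp (X n) 2 μ) (hsum : Summable fun n => Var[X n; μ]) :
    ∀ᵐ ω ∂μ, Tendsto (fun n => X n ω - μ[X n]) atTop (𝓝 0) := by
  have hfin : ∫⁻ ω, ∑' n, ENNReal.ofReal ((X n ω - μ[X n]) ^ 2) ∂μ ≠ ⊤ := by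
    rw [lintegral_tsum fun n => (((hm n).sub_const _).pow_const 2).ennreal_ofReal.aemeasurable]
    have h : ∀ n, ∫⁻ ω, ENNReal.ofReal ((X n ω - μ[X n]) ^ 2) ∂μ = ENNReal.ofReal Var[X n; μ] :=
      fun n => by rw [← evariance_eq_lintegral_ofReal, ofReal_variance (hX n)]
    simp only [h]
    exact hsum.tsum_ofReal_ne_top
  filter_upwards [ae_lt_top' (AEMeasurable.tsum fun n =>
    (((hm n).sub_const _).pow_const 2).ennreal_ofReal.aemeasurable) hfin] with ω hω
  have h1 := ENNReal.tendsto_atTop_zero_of_tsum_ne_top hω.ne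
  have h2 : Tendsto (fun n => (X n ω - μ[X n]) ^ 2) atTop (𝓝 0) := by
    have := (ENNReal.continuousAt_toReal ENNReal.zero_ne_top).tendsto.comp h1
    refine this.congr fun n => ?_
    simp [ENNReal.toReal_ofReal (sq_nonneg _)]
  have h3 : Tendsto (fun n => |X n ω - μ[X n]|) atTop (𝓝 0) := by
    have := (Real.continuous_sqrt.tendsto 0).comp h2
    rw [Real.sqrt_zero] at this
    exact this.congr fun n => Real.sqrt_sq_eq_abs _
  exact (tendsto_zero_iff_abs_tendsto_zero _).2 h3

/-- A bounded function that a translation turns into its negative has small sums over boxes: twice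
the sum is a difference of sums over two boxes that overlap up to a boundary layer. -/
lemma tendsto_average_of_antiperiodic {c : Site → ℝ} (hc : ∀ a, |c a| ≤ 1) {u : Site}
    (hu : ∀ a, c (a + u) = -c a) :
    Tendsto (fun n : ℕ => (∑ a ∈ box n, c a) / ((box n).card : ℝ)) atTop (𝓝 0) := by
  set k := max u.1.natAbs u.2.natAbs with hk
  have hdiff : ∀ {A D : Finset Site}, A ⊆ D →
      |∑ a ∈ D, c a - ∑ a ∈ A, c a| ≤ D.card - A.card := by
    intro A D h
    rw [← Finset.sum_sdiff h, add_sub_cancel_right]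
    refine (Finset.abs_sum_le_sum_abs _ _).trans ((Finset.sum_le_sum fun a _ => hc a).trans ?_)
    rw [Finset.sum_const, nsmul_eq_mul, mul_one, Finset.cast_card_sdiff h]
  have hbound : ∀ n : ℕ, |∑ a ∈ box n, c a| ≤ ((box (n + k)).card : ℝ) - (box n).card := by
    intro n
    have hinj : Function.Injective (· + u : Site → Site) := add_left_injective u
    have h1 : box n ⊆ box (n + k) := fun a ha => by
      rw [box_eq_nearby, mem_nearby] at *
      push_cast
      omega
    have h2 : (box n).image (· + u) ⊆ box (n + k) := fun a ha => by
      obtain ⟨b, hb, rfl⟩ := Finset.mem_image.1 ha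
      have e1 : u.1.natAbs ≤ k := le_max_left _ _
      have e2 : u.2.natAbs ≤ k := le_max_right _ _
      rw [box_eq_nearby, mem_nearby] at *
      simp only [Prod.fst_zero, Prod.snd_zero, Prod.fst_add, Prod.snd_add] at *
      push_cast
      omega
    have h3 : ∑ a ∈ (box n).image (· + u), c a = -∑ a ∈ box n, c a := by
      rw [Finset.sum_image fun x _ y _ h => hinj h, ← Finset.sum_neg_distrib]
      exact Finset.sum_congr rfl fun a _ => hu a
    have h4 := hdiff h1
    have h5 := hdiff h2
    rw [h3, Finset.card_image_of_injective _ hinj] at h5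
    rw [abs_le] at *
    constructor <;> linarith
  have hlim : Tendsto (fun n : ℕ => (1 + 2 * (k : ℝ) / (2 * n + 1)) ^ 2 - 1) atTop (𝓝 0) := by
    have h1 : Tendsto (fun n : ℕ => 2 * (n : ℝ) + 1) atTop atTop :=
      tendsto_atTop_add_const_right _ 1
        (tendsto_natCast_atTop_atTop.const_mul_atTop (by norm_num))
    have h2 := (((tendsto_const_nhds (x := 2 * (k : ℝ))).div_atTop h1).const_add 1).pow 2
    have h3 := h2.sub_const 1
    simpa using h3
  refine squeeze_zero_norm (fun n => ?_) hlim
  have hpos : (0 : ℝ) < (2 * n + 1) ^ 2 := by positivity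
  rw [norm_div, Real.norm_eq_abs, Real.norm_natCast]
  have := hbound n
  rw [card_box, card_box] at this
  rw [card_box]
  push_cast at this ⊢
  rw [div_le_iff₀ hpos]
  refine this.trans_eq ?_
  field_simp
  ring

lemma measurable_magnetization (n : ℕ) : Measurable (magnetization n) :=
  (Finset.measurable_sum _ fun i _ => measurable_spin i).div_const _

lemma integral_spinAt (β t : ℝ) (η : Config) (a : Site) :
    ∫ ω, spinAt β t η a ω ∂noiseLaw = meanSpin β t η a := by
  rw [meanSpin, lawAt_eq_map, integral_map (measurable_state_right β t η).aemeasurable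
    (measurable_spin a).aestronglyMeasurable]
  rfl

lemma lawAt_centeredSector {t : ℝ} (ht : 0 ≤ t) (β : ℝ) {η : Config} {L : AddSubgroup Site}
    {u : Site} (hη : IsAntiperiodic L u η) : lawAt β t η centeredSector = 1 := by
  have hst := measurable_state_right β t η
  have hmeas : MeasurableSet centeredSector := measurableSet_tendsto _ measurable_magnetization
  refine (mem_ae_iff_prob_eq_one hmeas).1 ?_
  rw [lawAt_eq_map]
  refine (ae_map_iff hst.aemeasurable hmeas).2 ?_
  have hmean : ∀ n, ∫ ω, magnetization n (state β t η ω) ∂noiseLaw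
      = (∑ a ∈ box n, meanSpin β t η a) / ((box n).card : ℝ) := by
    intro n
    have : (fun ω => magnetization n (state β t η ω))
        = fun ω => (∑ a ∈ box n, spinAt β t η a ω) / ((box n).card : ℝ) := rfl
    rw [this, integral_div, integral_finsetSum _ fun a _ =>
      (memLp_spinAt β t η a).integrable (by norm_num)]
    simp only [integral_spinAt]
  have hm : ∀ n, Measurable fun ω => magnetization n (state β t η ω) :=
    fun n => (measurable_magnetization n).comp hst
  have hLp : ∀ n, MemLp (fun ω => magnetization n (state β t η ω)) 2 noiseLaw := by
    intro n
    have h := (memLp_finsetSum (box n) fun a _ => memLp_spinAt β t η a).const_mul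
      ((box n).card : ℝ)⁻¹
    refine h.congr_norm (hm n).aestronglyMeasurable (ae_of_all _ fun ω => ?_)
    rw [magnetization, div_eq_inv_mul]
    rfl
  have hsummable : Summable fun n : ℕ =>
      Var[fun ω => magnetization n (state β t η ω); noiseLaw] := by
    obtain ⟨K, hK⟩ := exists_variance_magnetization_le ht β η
    have hK0 : 0 ≤ K := by
      have := (variance_nonneg _ _).trans (hK 0)
      simpa using this
    have h1 : Summable fun n : ℕ => K * (1 / ((n : ℝ) + 1) ^ 2) := by
      have := (summable_nat_add_iff 1).2 (Real.summable_one_div_nat_pow.2 one_lt_two)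
      refine Summable.mul_left K (this.congr fun n => ?_)
      push_cast
      rfl
    refine Summable.of_nonneg_of_le (fun n => variance_nonneg _ _) (fun n => (hK n).trans ?_) h1
    rw [mul_one_div]
    gcongr
    linarith [(Nat.cast_nonneg n : (0 : ℝ) ≤ n)]
  have hc : ∀ a, |meanSpin β t η a| ≤ 1 := fun a => by
    have := norm_integral_le_of_norm_le_const (μ := lawAt β t η) (f := fun σ => spin σ a) (C := 1)
      (ae_of_all _ fun σ => (Real.norm_eq_abs _).trans_le (abs_spin σ a).le)
    simpa [meanSpin] using this
  have havg := tendsto_average_of_antiperiodic hc (hη.meanSpin_add ht β)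
  filter_upwards [ae_tendsto_sub_mean_of_summable_variance hm hLp hsummable] with ω hω
  have := hω.add havg
  rw [add_zero] at this
  refine this.congr fun n => ?_
  rw [hmean, sub_add_cancel]

end Glauber

theorem mainTheorem5 (β : ℝ) (η : Glauber.Config) (hη : η ∈ Glauber.antisymmetricConfigs)
    (t : ℝ) (ht : 0 ≤ t) :
    Glauber.lawAt β t η Glauber.centeredSector = 1 ∧
    ∀ (L : AddSubgroup Glauber.Site) (u : Glauber.Site), L.FiniteIndex →
      Glauber.IsAntiperiodic L u η →
      ErgodicVAdd L Glauber.Config (Glauber.lawAt β t η) ∧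
      ∃ c : Glauber.Site ⧸ L → ℝ,
        (∀ a : Glauber.Site, ∫ σ, Glauber.spin σ a ∂(Glauber.lawAt β t η) = c a) ∧
        (∀ a : Glauber.Site ⧸ L, c a = -c (a + (u : Glauber.Site ⧸ L))) ∧
        ∑ᶠ a : Glauber.Site ⧸ L, c a = 0 := by
  obtain ⟨L₀, -, u₀, h₀⟩ := hη
  refine ⟨Glauber.lawAt_centeredSector ht β h₀, fun L u hL hLu => ?_⟩
  refine ⟨Glauber.ergodicVAdd_lawAt β t hL hLu.1, ?_⟩
  have hwd : ∀ a b : Glauber.Site, QuotientAddGroup.leftRel L a b →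
      Glauber.meanSpin β t η a = Glauber.meanSpin β t η b := by
    intro a b hab
    have := hLu.meanSpin_add_of_mem β t (QuotientAddGroup.leftRel_apply.1 hab) a
    rwa [add_neg_cancel_left, eq_comm] at this
  set c : Glauber.Site ⧸ L → ℝ := fun q => Quotient.liftOn' q (Glauber.meanSpin β t η) hwd
  have hanti : ∀ a : Glauber.Site ⧸ L, c a = -c (a + (u : Glauber.Site ⧸ L)) := by
    intro q
    induction q using QuotientAddGroup.induction_on with
    | H a =>
      change Glauber.meanSpin β t η a = -Glauber.meanSpin β t η (a + u)
      rw [hLu.meanSpin_add ht, neg_neg]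
  refine ⟨c, fun a => rfl, hanti, ?_⟩
  have hsum : ∑ᶠ a, c a = -∑ᶠ a, c a := by
    calc ∑ᶠ a, c a = ∑ᶠ a, -c (a + (u : Glauber.Site ⧸ L)) := finsum_congr hanti
      _ = -∑ᶠ a, c (a + (u : Glauber.Site ⧸ L)) := finsum_neg_distrib _
      _ = -∑ᶠ a, c a :=
        congrArg Neg.neg (finsum_comp_equiv (Equiv.addRight (u : Glauber.Site ⧸ L)) (f := c))
  linarith
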